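/- Conventions. Let $d\ge 1$. $V$ is Lebesgue measure on $\mathbb C^d\cong\mathbb R^{2d}$ normalised so that the Euclidean unit ball has mass $1$, and for a non-empty open $\Omega\subset\mathbb C^d$, $A^2(\Omega)$ is the Bergman space of holomorphic $f:\Omega\to\mathbb C$ with $\int_\Omega|f|^2\,dV<\infty$, a Hilbert space with the inner product of $L^2(\Omega,V)$. Write $A\Subset B$ if the closure of $A$ is a compact subset of $B$. For a compact operator $A$ between Hilbert spaces, $s_n(A)=\sqrt{\lambda_n(A^*A)}$ ($n\ge1$), where the eigenvalues are listed in decreasing order with multiplicity (continued by zeros if there are only finitely many positive ones); for $a,\alpha>0$ put $|A|_{a,\alpha}=\sup_{n\ge1}s_n(A)\exp(an^\alpha)$, and let $E(a,\alpha)$ be the class of compact $A$ with $|A|_{a,\alpha}<\infty$. A holomorphic map-weight system on $(\Omega,\Omega')$ ($\Omega,\Omega'\subset\mathbb C^d$ non-empty open) consists of families $(\phi_i)_{i\in\mathcal I}$, $(w_i)_{i\in\mathcal I}$, with $\mathcal I$ finite or countably infinite, where $\phi_i:\Omega\to\Omega'$ is holomorphic, $\bigcup_i\phi_i(\Omega)\Subset\Omega'$,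 $w_i\in A^2(\Omega)$ and $\sum_i|w_i|\in L^2(\Omega,V)$. Its transfer operator is the bounded operator $\mathcal L:A^2(\Omega')\to A^2(\Omega)$, $\mathcal Lf=\sum_{i}w_i\cdot(f\circ\phi_i)$ (convergence in $A^2(\Omega)$). A set $D\subset\mathbb C^d$ is strictly circled with centre $\zeta$ if $\mu(D-\zeta)\Subset D-\zeta$ for all $\mu\in\mathbb C$ with $|\mu|<1$; put $D(r)=r(D-\zeta)+\zeta$. A relative cover of size $N$ of a pair $(\Omega_1,\Omega_2)$ is a family $D_1,\dots,D_N$ of strictly circled open sets with $\Omega_2\subset\bigcup_nD_n$, for which there are $\gamma_1,\dots,\gamma_N>1$ with $\bigcup_nD_n(\gamma_n)\subset\Omega_1$; $\Gamma=(\log\gamma_1,\dots,\log\gamma_N)$ is its efficiency (for this choice of the $\gamma_n$), $\min(\Gamma)$ denotes the smallest entry of $\Gamma$, and $\|\Gamma\|_d=\bigl(\sum_{n}(\log\gamma_n)^{-d}\bigr)^{-1/d}$. Theorem. Let $(\phi_i,w_i)_{i\in\mathcal I}$ be a holomorphic map-weight system on $(\Omega,\Omega')$, let $\widetilde\Omega\subset\mathbb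 C^d$ be a non-empty open set with $$\bigcup_{i\in\mathcal I}\phi_i(\Omega)\Subset\widetilde\Omega\Subset\Omega',$$ put $r_i=\operatorname{dist}(\phi_i(\Omega),\partial\widetilde\Omega)$, and suppose that $(\Omega',\widetilde\Omega)$ has a relative cover of size $N$ with efficiency $\Gamma$. Then the transfer operator $\mathcal L:A^2(\Omega')\to A^2(\Omega)$ exists and is unique, $\sum_i|w_i|r_i^{-d}\in L^2(\Omega,V)$, and $\mathcal L\in E(c,1/d)$ with $c=\|\Gamma\|_d$ and $$|\mathcal L|_{c,1/d}\le N\,e^{-\frac{d-1}{2}\min(\Gamma)}\,\Bigl\|\sum_{i\in\mathcal I}|w_i|\,r_i^{-d}\Bigr\|_{L^2(\Omega,V)}.$$ Hence $s_n(\mathcal L)\le B\,e^{-cn^{1/d}}$ for all $n\ge1$, with $B=|\mathcal L|_{c,1/d}$. -/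

import Mathlib

open MeasureTheory Set Filter Topology
open scoped ENNReal

/-- Complex Euclidean space `ℂ^d`, with its Euclidean norm. -/
abbrev Cn (d : ℕ) : Type := EuclideanSpace ℂ (Fin d)

/-- Lebesgue measure on `ℂ^d ≅ ℝ^{2d}`, normalised so that the Euclidean unit ball has mass `1`. -/
noncomputable def normVol (d : ℕ) : Measure (Cn d) :=
  (volume (Metric.ball (0 : Cn d) 1))⁻¹ • volume

instance normVol_isAddHaar (d : ℕ) : (normVol d).IsAddHaarMeasure :=
  Measure.IsAddHaarMeasure.smul _
    (ENNReal.inv_ne_zero.2 measure_ball_lt_top.ne)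
    (ENNReal.inv_ne_top.2 (Metric.measure_ball_pos _ _ one_pos).ne')

/-- Multiplication by a complex number of modulus one, as a real linear isometry of `ℂ^d`. -/
noncomputable def rotE {d : ℕ} (c : ℂ) (hc : ‖c‖ = 1) : Cn d ≃ₗᵢ[ℝ] Cn d where
  toLinearEquiv :=
    (LinearEquiv.smulOfNeZero ℂ (Cn d) c (by rintro rfl; simp at hc)).restrictScalars ℝ
  norm_map' x := by simp [norm_smul, hc]

theorem rotE_measurePreserving {d : ℕ} (c : ℂ) (hc : ‖c‖ = 1) :
    MeasurePreserving (fun u : Cn d => c • u) (normVol d) (normVol d) := by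
  have h := (rotE (d := d) c hc).measurePreserving
  exact h.smul_measure _

theorem subMean {d : ℕ} {f : Cn d → ℂ} {z : Cn d} {r : ℝ}
    (hf : DifferentiableOn ℂ f (Metric.ball z r)) :
    normVol d (Metric.ball 0 r) * ‖f z‖ₑ ≤ ∫⁻ x in Metric.ball z r, ‖f x‖ₑ ∂(normVol d) := by
  classical
  set g : Cn d → ℂ := (Metric.ball z r).indicator f with hg
  have hgm : Measurable g := by
    have h1 : StronglyMeasurable g := by
      have : ContinuousOn f (Metric.ball z r) := hf.continuousOn
      have h2 : Measurable ((Metric.ball z r).piecewise f 0) :=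
        this.measurable_piecewise continuousOn_const Metric.isOpen_ball.measurableSet
      rw [hg, ← Set.piecewise_eq_indicator]
      exact h2.stronglyMeasurable
    exact h1.measurable
  have hpt : ∀ u ∈ Metric.ball (0 : Cn d) r, ENNReal.ofReal (2 * Real.pi) * ‖f z‖ₑ ≤
      ∫⁻ θ in Ioc 0 (2 * Real.pi), ‖g (z + circleMap 0 1 θ • u)‖ₑ := by
    intro u hu
    have hu' : ‖u‖ < r := by simpa using hu
    have hmap : ∀ ζ : ℂ, ‖ζ‖ ≤ 1 → z + ζ • u ∈ Metric.ball z r := by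
      intro ζ hζ
      simp only [Metric.mem_ball, dist_self_add_left, norm_smul]
      calc ‖ζ‖ * ‖u‖ ≤ 1 * ‖u‖ := by gcongr
        _ < r := by simpa using hu'
    have hd : DifferentiableOn ℂ (fun ζ : ℂ => f (z + ζ • u)) (Metric.closedBall 0 1) := by
      refine hf.comp (f := fun ζ : ℂ => z + ζ • u) (by fun_prop) ?_
      intro ζ hζ
      exact hmap ζ (by simpa using hζ)
    have hcl : DiffContOnCl ℂ (fun ζ : ℂ => f (z + ζ • u)) (Metric.ball 0 |1|) := by
      rw [abs_one]
      apply DifferentiableOn.diffContOnCl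
      rwa [closure_ball _ one_ne_zero]
    have hav := hcl.circleAverage
    rw [Real.circleAverage_def] at hav
    simp only [zero_smul, add_zero] at hav
    have h2 : (∫ θ in (0:ℝ)..2 * Real.pi, f (z + circleMap 0 1 θ • u)) = (2 * Real.pi) • f z := by
      rw [← hav, smul_smul, mul_inv_cancel₀ (by positivity), one_smul]
    have h3 : ∀ θ : ℝ, g (z + circleMap 0 1 θ • u) = f (z + circleMap 0 1 θ • u) := by
      intro θ
      exact Set.indicator_of_mem (hmap _ (by simp)) _
    simp_rw [h3]
    calc ENNReal.ofReal (2 * Real.pi) * ‖f z‖ₑ = ‖(2 * Real.pi) • f z‖ₑ := by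
          rw [enorm_smul, Real.enorm_of_nonneg (by positivity)]
      _ ≤ _ := by
          rw [← h2, intervalIntegral.integral_of_le (by positivity)]
          exact enorm_integral_le_lintegral_enorm _
  have hjm : Measurable (fun p : Cn d × ℝ => ‖g (z + circleMap 0 1 p.2 • p.1)‖ₑ) := by
    refine (hgm.comp ?_).enorm
    have : Continuous (fun p : Cn d × ℝ => z + circleMap 0 1 p.2 • p.1) := by fun_prop
    exact this.measurable
  have hinv : ∀ θ : ℝ, ∫⁻ u, ‖g (z + circleMap 0 1 θ • u)‖ₑ ∂(normVol d) =
      ∫⁻ x, ‖g x‖ₑ ∂(normVol d) := by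
    intro θ
    have h1 := (rotE_measurePreserving (d := d) (circleMap 0 1 θ) (by simp)).lintegral_comp
      (f := fun x => ‖g (z + x)‖ₑ) ((hgm.comp (measurable_const_add z)).enorm)
    rw [h1]
    exact lintegral_add_left_eq_self (μ := normVol d) (fun x => ‖g x‖ₑ) z
  have key : ENNReal.ofReal (2 * Real.pi) * (normVol d (Metric.ball 0 r) * ‖f z‖ₑ) ≤
      ENNReal.ofReal (2 * Real.pi) * ∫⁻ x, ‖g x‖ₑ ∂(normVol d) := by
    calc ENNReal.ofReal (2 * Real.pi) * (normVol d (Metric.ball 0 r) * ‖f z‖ₑ)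
        = ∫⁻ _u in Metric.ball (0 : Cn d) r, ENNReal.ofReal (2 * Real.pi) * ‖f z‖ₑ
            ∂(normVol d) := by
          rw [setLIntegral_const]; ring
      _ ≤ ∫⁻ u in Metric.ball (0 : Cn d) r,
            (∫⁻ θ in Ioc 0 (2 * Real.pi), ‖g (z + circleMap 0 1 θ • u)‖ₑ) ∂(normVol d) :=
          setLIntegral_mono' measurableSet_ball hpt
      _ ≤ ∫⁻ u, (∫⁻ θ in Ioc 0 (2 * Real.pi), ‖g (z + circleMap 0 1 θ • u)‖ₑ) ∂(normVol d) :=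
          setLIntegral_le_lintegral _ _
      _ = ∫⁻ θ in Ioc 0 (2 * Real.pi), ∫⁻ u, ‖g (z + circleMap 0 1 θ • u)‖ₑ ∂(normVol d) :=
          lintegral_lintegral_swap hjm.aemeasurable
      _ = ENNReal.ofReal (2 * Real.pi) * ∫⁻ x, ‖g x‖ₑ ∂(normVol d) := by
          simp_rw [hinv]
          rw [setLIntegral_const, Real.volume_Ioc, sub_zero, mul_comm]
  have h0 : ENNReal.ofReal (2 * Real.pi) ≠ 0 := by
    simp [Real.pi_pos]
  have := (ENNReal.mul_le_mul_iff_right h0 ENNReal.ofReal_ne_top).1 key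
  refine this.trans (le_of_eq ?_)
  rw [← lintegral_indicator measurableSet_ball]
  congr 1
  ext x
  by_cases hx : x ∈ Metric.ball z r <;> simp [hg, hx]

/-- Point evaluations are bounded in the `L²` norm, uniformly over balls of a given radius. -/
theorem pointBound {d : ℕ} {r : ℝ} (hr : 0 < r) : ∃ C : ℝ, 0 ≤ C ∧
    ∀ (Ω : Set (Cn d)) (z : Cn d), Metric.ball z r ⊆ Ω →
    ∀ f : Cn d → ℂ, DifferentiableOn ℂ f Ω → IsOpen Ω →
    eLpNorm f 2 ((normVol d).restrict Ω) ≠ ∞ →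
      ‖f z‖ ≤ C * (eLpNorm f 2 ((normVol d).restrict Ω)).toReal := by
  set m : ℝ≥0∞ := normVol d (Metric.ball 0 r) with hm
  have hm0 : m ≠ 0 := (Metric.measure_ball_pos _ _ hr).ne'
  have hmt : m ≠ ∞ := measure_ball_lt_top.ne
  set K : ℝ≥0∞ := m⁻¹ * m ^ (1 / (1:ℝ≥0∞).toReal - 1 / (2:ℝ≥0∞).toReal) with hK
  have hKt : K ≠ ∞ := ENNReal.mul_ne_top (ENNReal.inv_ne_top.2 hm0)
    (ENNReal.rpow_ne_top_of_nonneg (by norm_num) hmt)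
  refine ⟨K.toReal, ENNReal.toReal_nonneg, ?_⟩
  intro Ω z hz f hf hΩ hfin
  have h1 := subMean (hf.mono hz)
  have hmeas : AEStronglyMeasurable f ((normVol d).restrict (Metric.ball z r)) :=
    ((hf.mono hz).continuousOn).aestronglyMeasurable measurableSet_ball
  have h2 := eLpNorm_le_eLpNorm_mul_rpow_measure_univ (p := 1) (q := 2) (by norm_num) hmeas
  rw [eLpNorm_one_eq_lintegral_enorm] at h2
  have h3 : eLpNorm f 2 ((normVol d).restrict (Metric.ball z r)) ≤
      eLpNorm f 2 ((normVol d).restrict Ω) := eLpNorm_mono_measure _ (Measure.restrict_mono hz le_rfl)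
  have hball : normVol d (Metric.ball z r) = m := by
    rw [hm]; exact Measure.addHaar_ball_center _ _ _
  rw [Measure.restrict_apply_univ, hball] at h2
  have h4 : m * ‖f z‖ₑ ≤ eLpNorm f 2 ((normVol d).restrict Ω) *
      m ^ (1 / (1:ℝ≥0∞).toReal - 1 / (2:ℝ≥0∞).toReal) := h1.trans (h2.trans (by gcongr))
  have h5 : ‖f z‖ₑ ≤ K * eLpNorm f 2 ((normVol d).restrict Ω) := by
    calc ‖f z‖ₑ = m⁻¹ * (m * ‖f z‖ₑ) := by
          rw [← mul_assoc, ENNReal.inv_mul_cancel hm0 hmt, one_mul]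
      _ ≤ m⁻¹ * (eLpNorm f 2 ((normVol d).restrict Ω) *
          m ^ (1 / (1:ℝ≥0∞).toReal - 1 / (2:ℝ≥0∞).toReal)) := by gcongr
      _ = _ := by rw [hK]; ring
  have h6 := ENNReal.toReal_mono (ENNReal.mul_ne_top hKt hfin) h5
  simpa [ENNReal.toReal_mul] using h6

/-- A pointwise limit of holomorphic functions which is uniform on a ball is differentiable at the
centre. -/
theorem weierstrass {d : ℕ} {F : ℕ → Cn d → ℂ} {g : Cn d → ℂ} {z : Cn d} {r : ℝ} (hr : 0 < r)
    (hF : ∀ n, DifferentiableOn ℂ (F n) (Metric.ball z (r + r)))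
    (hC : ∀ ε > 0, ∃ N, ∀ m ≥ N, ∀ n ≥ N, ∀ x ∈ Metric.ball z (r + r), ‖F m x - F n x‖ ≤ ε)
    (hlim : ∀ x ∈ Metric.ball z (r + r), Tendsto (fun n => F n x) atTop (𝓝 (g x))) :
    DifferentiableAt ℂ g z := by
  have hsub : ∀ y ∈ Metric.ball z r, Metric.ball y r ⊆ Metric.ball z (r + r) := by
    intro y hy
    apply Metric.ball_subset_ball'
    have := Metric.mem_ball.1 hy
    linarith
  have hsub' : Metric.ball z r ⊆ Metric.ball z (r + r) := Metric.ball_subset_ball (by linarith)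
  have hdiff : ∀ n, ∀ y ∈ Metric.ball z r, DifferentiableAt ℂ (F n) y := fun n y hy =>
    (hF n).differentiableAt (Metric.isOpen_ball.mem_nhds (hsub' hy))
  have hUC : ∀ ε > 0, ∃ N, ∀ m ≥ N, ∀ n ≥ N, ∀ y ∈ Metric.ball z r,
      dist (fderiv ℂ (F m) y) (fderiv ℂ (F n) y) < ε := by
    intro ε hε
    obtain ⟨N, hN⟩ := hC (ε * r / 4) (by positivity)
    refine ⟨N, fun m hm n hn y hy => ?_⟩
    have hd : DifferentiableOn ℂ (F m - F n) (Metric.ball y r) :=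
      ((hF m).sub (hF n)).mono (hsub y hy)
    have hmaps : MapsTo (F m - F n) (Metric.ball y r)
        (Metric.closedBall ((F m - F n) y) (ε * r / 2)) := by
      intro x hx
      have h1 := hN m hm n hn x (hsub y hy hx)
      have h2 := hN m hm n hn y (hsub' hy)
      rw [Metric.mem_closedBall, dist_eq_norm]
      refine (norm_sub_le _ _).trans ?_
      simp only [Pi.sub_apply]
      linarith
    have h := Complex.norm_fderiv_le_div_of_mapsTo_ball hd hmaps hr
    rw [fderiv_sub (hdiff m y hy) (hdiff n y hy)] at h
    rw [dist_eq_norm]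
    refine h.trans_lt ?_
    rw [div_lt_iff₀ hr]
    nlinarith [mul_pos hε hr]
  have hUC' : UniformCauchySeqOn (fun n y => fderiv ℂ (F n) y) atTop (Metric.ball z r) :=
    Metric.uniformCauchySeqOn_iff.2 hUC
  have hex : ∀ y ∈ Metric.ball z r, ∃ L, Tendsto (fun n => fderiv ℂ (F n) y) atTop (𝓝 L) := by
    intro y hy
    apply cauchySeq_tendsto_of_complete
    rw [Metric.cauchySeq_iff]
    intro ε hε
    obtain ⟨N, hN⟩ := hUC ε hε
    exact ⟨N, fun m hm n hn => hN m hm n hn y hy⟩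
  classical
  choose! G hG using hex
  have hunif := hUC'.tendstoUniformlyOn_of_tendsto hG
  exact (hasFDerivAt_of_tendstoUniformlyOn Metric.isOpen_ball hunif
    (fun n x hx => (hdiff n x hx).hasFDerivAt) (fun x hx => hlim x (hsub' hx))
    (Metric.mem_ball_self hr)).differentiableAt

/-- The subspace of `L²(Ω, V)` of (classes of) square-integrable functions that are holomorphic
on `Ω`. -/
noncomputable def bergmanSubmodule {d : ℕ} (Ω : TopologicalSpace.Opens (Cn d)) :
    Submodule ℂ (Lp ℂ 2 ((normVol d).restrict (Ω : Set (Cn d)))) where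
  carrier := {F | ∃ f : Cn d → ℂ, DifferentiableOn ℂ f Ω ∧
    F =ᵐ[(normVol d).restrict (Ω : Set (Cn d))] f}
  zero_mem' := ⟨0, differentiableOn_const 0, Lp.coeFn_zero _ _ _⟩
  add_mem' := by
    rintro F G ⟨f, hf, hFf⟩ ⟨g, hg, hGg⟩
    exact ⟨f + g, hf.add hg, (Lp.coeFn_add F G).trans (hFf.add hGg)⟩
  smul_mem' := by
    rintro c F ⟨f, hf, hFf⟩
    exact ⟨c • f, hf.const_smul c, (Lp.coeFn_smul c F).trans (hFf.const_smul c)⟩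

/-- The Bergman space `A²(Ω)`, with the inner product `∫_Ω f ḡ dV` of `L²(Ω, V)`. -/
abbrev Bergman {d : ℕ} (Ω : TopologicalSpace.Opens (Cn d)) : Type := bergmanSubmodule Ω

namespace Bergman

variable {d : ℕ} {Ω : TopologicalSpace.Opens (Cn d)}

/-- The holomorphic function on `Ω` which an element of `A²(Ω)` is (extended by `0` off `Ω`). -/
noncomputable def toFun (F : Bergman Ω) : Cn d → ℂ :=
  (Ω : Set (Cn d)).indicator (Classical.choose F.2)

noncomputable instance : CoeFun (Bergman Ω) (fun _ => Cn d → ℂ) := ⟨toFun⟩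

theorem differentiableOn (F : Bergman Ω) : DifferentiableOn ℂ F Ω :=
  (Classical.choose_spec F.2).1.congr fun _ hx => Set.indicator_of_mem hx _

theorem ae_eq (F : Bergman Ω) :
    (F : Lp ℂ 2 ((normVol d).restrict (Ω : Set (Cn d))))
      =ᵐ[(normVol d).restrict (Ω : Set (Cn d))] F.toFun := by
  refine (Classical.choose_spec F.2).2.trans ?_
  filter_upwards [ae_restrict_mem Ω.isOpen.measurableSet] with x hx
  exact (Set.indicator_of_mem hx _).symm

/-- An element of `A²(Ω)` has only one holomorphic representative on `Ω`. -/
theorem eqOn_toFun (F : Bergman Ω) {f : Cn d → ℂ} (hf : DifferentiableOn ℂ f Ω)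
    (h : (F : Lp ℂ 2 ((normVol d).restrict (Ω : Set (Cn d))))
      =ᵐ[(normVol d).restrict (Ω : Set (Cn d))] f) : EqOn F f Ω :=
  Measure.eqOn_open_of_ae_eq (F.ae_eq.symm.trans h) Ω.isOpen
    F.differentiableOn.continuousOn hf.continuousOn

theorem ext_on {F G : Bergman Ω} (h : EqOn F.toFun G.toFun Ω) : F = G := by
  apply Subtype.ext
  apply Lp.ext
  refine F.ae_eq.trans (EventuallyEq.trans ?_ G.ae_eq.symm)
  filter_upwards [ae_restrict_mem Ω.isOpen.measurableSet] with x hx using h hx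

theorem eqOn_sub (F G : Bergman Ω) : EqOn (F - G).toFun (F.toFun - G.toFun) Ω := by
  refine eqOn_toFun _ (F.differentiableOn.sub G.differentiableOn) ?_
  have := Lp.coeFn_sub (F : Lp ℂ 2 ((normVol d).restrict (Ω : Set (Cn d))))
    (G : Lp ℂ 2 ((normVol d).restrict (Ω : Set (Cn d))))
  exact this.trans (F.ae_eq.sub G.ae_eq)

theorem toReal_eLpNorm (F : Bergman Ω) :
    (eLpNorm F.toFun 2 ((normVol d).restrict (Ω : Set (Cn d)))).toReal = ‖F‖ := by
  rw [← eLpNorm_congr_ae F.ae_eq, Submodule.coe_norm, Lp.norm_def]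

theorem eLpNorm_ne_top (F : Bergman Ω) :
    eLpNorm F.toFun 2 ((normVol d).restrict (Ω : Set (Cn d))) ≠ ∞ := by
  rw [← eLpNorm_congr_ae F.ae_eq]
  exact Lp.eLpNorm_ne_top _

theorem isClosed : IsClosed (bergmanSubmodule Ω : Set (Lp ℂ 2 ((normVol d).restrict (Ω : Set (Cn d))))) := by
  rw [← isSeqClosed_iff_isClosed]
  intro F0 G hF0 hlim
  let F : ℕ → Bergman Ω := fun n => ⟨F0 n, hF0 n⟩
  have hcau : CauchySeq F0 := hlim.cauchySeq
  have hloc : ∀ z ∈ Ω, ∃ r > 0, Metric.ball z (r + r) ⊆ Ω ∧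
      ∀ ε > 0, ∃ N, ∀ m ≥ N, ∀ n ≥ N, ∀ x ∈ Metric.ball z (r + r), ‖F m x - F n x‖ ≤ ε := by
    intro z hz
    obtain ⟨R, hR, hball⟩ := Metric.isOpen_iff.1 Ω.isOpen z hz
    have hsub : ∀ x ∈ Metric.ball z (R / 4 + R / 4), Metric.ball x (R / 2) ⊆ (Ω : Set (Cn d)) := by
      intro x hx
      refine (Metric.ball_subset_ball' ?_).trans hball
      have := Metric.mem_ball.1 hx
      linarith
    refine ⟨R / 4, by positivity, (Metric.ball_subset_ball (by linarith)).trans hball, ?_⟩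
    obtain ⟨C, hC0, hC⟩ := pointBound (d := d) (r := R / 2) (by positivity)
    intro ε hε
    obtain ⟨N, hN⟩ := Metric.cauchySeq_iff.1 hcau (ε / (C + 1)) (by positivity)
    refine ⟨N, fun m hm n hn x hx => ?_⟩
    have h1 := hC Ω x (hsub x hx) (F m - F n).toFun (F m - F n).differentiableOn Ω.isOpen
      (F m - F n).eLpNorm_ne_top
    rw [toReal_eLpNorm] at h1
    have hxΩ : x ∈ (Ω : Set (Cn d)) := hsub x hx (Metric.mem_ball_self (by positivity))
    rw [eqOn_sub (F m) (F n) hxΩ] at h1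
    have h2 : ‖F m - F n‖ ≤ ε / (C + 1) := by
      have := hN m hm n hn
      rw [dist_eq_norm] at this
      exact this.le
    refine h1.trans ?_
    calc C * ‖F m - F n‖ ≤ C * (ε / (C + 1)) := by gcongr
      _ ≤ ε := by
        rw [mul_div_assoc', div_le_iff₀ (by positivity)]
        nlinarith
  have hex : ∀ x ∈ Ω, ∃ y, Tendsto (fun n => F n x) atTop (𝓝 y) := by
    intro x hx
    obtain ⟨r, hr, -, h⟩ := hloc x hx
    apply cauchySeq_tendsto_of_complete
    rw [Metric.cauchySeq_iff]
    intro ε hε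
    obtain ⟨N, hN⟩ := h (ε / 2) (by positivity)
    refine ⟨N, fun m hm n hn => ?_⟩
    rw [dist_eq_norm]
    exact (hN m hm n hn x (Metric.mem_ball_self (by positivity))).trans_lt (by linarith)
  choose! g hg using hex
  refine ⟨g, ?_, ?_⟩
  · intro z hz
    obtain ⟨r, hr, hsub, h⟩ := hloc z hz
    exact (weierstrass hr (fun n => (F n).differentiableOn.mono hsub) h
      (fun x hx => hg x (hsub hx))).differentiableWithinAt
  · obtain ⟨ns, hns, hae⟩ := (tendstoInMeasure_of_tendsto_Lp hlim).exists_seq_tendsto_ae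
    have hall : ∀ᵐ x ∂((normVol d).restrict (Ω : Set (Cn d))), ∀ n, F0 n x = F n x :=
      ae_all_iff.2 fun n => (F n).ae_eq
    filter_upwards [hae, hall, ae_restrict_mem Ω.isOpen.measurableSet] with x h1 h2 h3
    have h4 := (hg x h3).comp hns.tendsto_atTop
    refine tendsto_nhds_unique h1 (h4.congr fun n => ?_)
    simp [h2]

/-- `A²(Ω)` is a Hilbert space. -/
noncomputable instance : CompleteSpace (Bergman Ω) := isClosed.completeSpace_coe

end Bergman

/-- The eigenvalue modulus `|λ_n(T)|`, `n ≥ 1`, of a compact operator `T`: its nonzero eigenvalues,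
repeated according to algebraic multiplicity, are listed by decreasing modulus and the list is
continued by zeros if there are only finitely many. So `|λ_n(T)|` is the largest `t > 0` such that
the eigenvalues of modulus at least `t` have total multiplicity at least `n`, and `0` if there is
no such `t` (the supremum of the empty set of reals is `0`). -/
noncomputable def eigenvalueModulus {H : Type*} [NormedAddCommGroup H] [InnerProductSpace ℂ H]
    (T : H →L[ℂ] H) (n : ℕ) : ℝ :=
  sSup {t : ℝ | 0 < t ∧ (n : Cardinal) ≤ Module.rank ℂ
    (⨆ μ ∈ {μ : ℂ | t ≤ ‖μ‖}, Module.End.maxGenEigenspace (T : Module.End ℂ H) μ :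
      Submodule ℂ H)}

section ExponentialClass

variable {H₁ H₂ : Type*} [NormedAddCommGroup H₁] [InnerProductSpace ℂ H₁] [CompleteSpace H₁]
  [NormedAddCommGroup H₂] [InnerProductSpace ℂ H₂] [CompleteSpace H₂]

/-- The `n`-th singular value `s_n(A) = √λ_n(A*A)`, `n ≥ 1`, of a compact operator `A`; the
eigenvalues of `A*A` are nonnegative, hence equal to their moduli. -/
noncomputable def singularValue (A : H₁ →L[ℂ] H₂) (n : ℕ) : ℝ :=
  √(eigenvalueModulus (ContinuousLinearMap.adjoint A ∘L A) n)

/-- The gauge `|A|_{a,α} = sup_{n ≥ 1} s_n(A) exp(a n^α)`, a number in `[0, ∞]`. -/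
noncomputable def expGauge (a α : ℝ) (A : H₁ →L[ℂ] H₂) : ℝ≥0∞ :=
  ⨆ (n : ℕ) (_ : 1 ≤ n), ENNReal.ofReal (singularValue A n * Real.exp (a * (n : ℝ) ^ α))

/-- The exponential class `E(a, α)`: compact operators with finite gauge `|A|_{a,α}`. -/
def expClass (a α : ℝ) : Set (H₁ →L[ℂ] H₂) :=
  {A | IsCompactOperator A ∧ expGauge a α A < ∞}

end ExponentialClass

/-- `A` is compactly contained in `B`: the closure of `A` is a compact subset of `B`. -/
def CompactlyContained {d : ℕ} (A B : Set (Cn d)) : Prop :=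
  IsCompact (closure A) ∧ closure A ⊆ B

/-- The distance `inf {|a - b| : a ∈ A, b ∈ B}` between two nonempty sets. -/
noncomputable def setDist {d : ℕ} (A B : Set (Cn d)) : ℝ :=
  sInf (Set.image2 dist A B)

/-- `D` is strictly circled with centre `ζ`: for every complex `μ` with `|μ| < 1`, the set
`μ (D - ζ)` is compactly contained in `D - ζ`. -/
def StrictlyCircled {d : ℕ} (D : Set (Cn d)) (ζ : Cn d) : Prop :=
  ∀ μ : ℂ, ‖μ‖ < 1 →
    CompactlyContained ((fun z => μ • (z - ζ)) '' D) ((fun z => z - ζ) '' D)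

/-- The dilated set `D(r) = r (D - ζ) + ζ`. -/
def dilate {d : ℕ} (ζ : Cn d) (r : ℝ) (D : Set (Cn d)) : Set (Cn d) :=
  (fun z => (r : ℂ) • (z - ζ) + ζ) '' D

/-- A relative cover of size `N` of the pair `(Ω₁, Ω₂)`, together with a scaling of it. -/
structure RelativeCover {d : ℕ} (Ω₁ Ω₂ : Set (Cn d)) (N : ℕ) where
  /-- The covering sets `D_n`. -/
  dom : Fin N → Set (Cn d)
  /-- Their centres. -/
  centre : Fin N → Cn d
  /-- The scaling `γ_n`. -/
  scaling : Fin N → ℝ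
  isOpen_dom : ∀ n, IsOpen (dom n)
  strictlyCircled : ∀ n, StrictlyCircled (dom n) (centre n)
  one_lt_scaling : ∀ n, 1 < scaling n
  covers : Ω₂ ⊆ ⋃ n, dom n
  dilate_subset : (⋃ n, dilate (centre n) (scaling n) (dom n)) ⊆ Ω₁

/-- The efficiency `Γ = (log γ_1, …, log γ_N)`. -/
noncomputable def RelativeCover.efficiency {d : ℕ} {Ω₁ Ω₂ : Set (Cn d)} {N : ℕ}
    (C : RelativeCover Ω₁ Ω₂ N) (n : Fin N) : ℝ :=
  Real.log (C.scaling n)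

/-- `‖(x_1, …, x_N)‖_d = (∑ |x_j|^{-d})^{-1/d}`. -/
noncomputable def efficiencyNorm (d : ℕ) {N : ℕ} (x : Fin N → ℝ) : ℝ :=
  (∑ j, |x j| ^ (-(d : ℝ))) ^ (-(1 / (d : ℝ)))

/-- A holomorphic map-weight system on `(Ω, Ω')`. The last field says that the sum of the moduli of
the weights, as a function with values in `[0, ∞]`, lies in `L²(Ω, V)`. -/
structure HolomorphicMapWeightSystem {d : ℕ} (Ω Ω' : TopologicalSpace.Opens (Cn d))
    (I : Type*) where
  /-- The maps `φ_i : Ω → Ω'`; their values off `Ω` play no role. -/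
  φ : I → Cn d → Cn d
  /-- The weights `w_i ∈ A²(Ω)`. -/
  w : I → Bergman Ω
  holomorphic : ∀ i, DifferentiableOn ℂ (φ i) Ω
  compactlyContained : CompactlyContained (⋃ i, φ i '' Ω) Ω'
  memLp : MemLp (fun z => ∑' i, ‖w i z‖ₑ) 2 ((normVol d).restrict (Ω : Set (Cn d)))

/-- `L` is the transfer operator `∑_i M_{w_i} C_{φ_i} : A²(Ω') → A²(Ω)` of the system `S`: for every
`f ∈ A²(Ω')` the functions `w_i · (f ∘ φ_i)` lie in `A²(Ω)` and their sum converges in `A²(Ω)`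
to `L f`. -/
def HolomorphicMapWeightSystem.IsTransferOperator {d : ℕ} {Ω Ω' : TopologicalSpace.Opens (Cn d)}
    {I : Type*} (S : HolomorphicMapWeightSystem Ω Ω' I) (L : Bergman Ω' →L[ℂ] Bergman Ω) : Prop :=
  ∀ f : Bergman Ω', ∃ g : I → Bergman Ω,
    (∀ i, Set.EqOn (g i) (fun z => S.w i z * f (S.φ i z)) Ω) ∧ HasSum g (L f)

/-! The operator sees `f` only through its restriction to the intermediate set. Since the unit ball
has mass `1`, the sub-mean value property and Cauchy-Schwarz on a ball of radius `r_i` about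
`φ_i(z)` give `|f(φ_i(z))| ≤ r_i^{-d} ‖f‖`, with the norm of `L²(Ω̃)`. Summing over `i` yields `‖L
f‖ ≤ M ‖f‖_{L²(Ω̃)}`, where `M` is the `L²` norm of `∑ |w_i| r_i^{-d}`. The same majorant makes the
defining series converge.

It remains to make the restriction `A²(Ω') → L²(Ω̃)` small on a subspace of codimension less than
`n`, which bounds `s_n` (`singularValue_le_of_norm_le_on_ker`). Take the functions vanishing to
order `K_j` at the centre of each `D_j`. Their Taylor polynomials of degree below `K_j` lie in a
space of dimension at most `K_j^d`, so the codimension is at most `∑ K_j^d`.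

For such `f`, passing from `D(γ)` to `D` contracts the `L²` norm by `γ^{-(K+d)}`. With the centre at
`0`, consider the correlation `H(ζ) = ∫_D f(ζu) conj(f(u)) dV(u)`. It is holomorphic, vanishes to
order `K` at `0`, and on `|ζ| = ρ < γ` satisfies `|H|² ≤ ρ^{-2d} I A`, where `I` and `A` are the
integrals of `|f|²` over `D(γ)` and `D`. As `H(1) = A`, the Schwarz lemma gives `A² ≤ ρ^{-2(K+d)} I
A`; divide by `A` and let `ρ → γ`.

Finally, with `g_j = log γ_j` and `c = ‖Γ‖_d`, the numbers `x_j = c n^{1/d} / g_j` satisfy `∑ x_j^d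
= n`. Rounding `x_j - (d+1)/2` up to `K_j` keeps `∑ K_j^d < n`, while `K_j + d ≥ x_j + (d-1)/2`. The
first term of this exponent produces `exp(-c n^{1/d})`, the second the prefactor with `min(Γ)`. -/

/-! ### Singular values and compactness from bounds on subspaces of finite codimension. -/

section SingularValues

variable {H₁ H₂ : Type*} [NormedAddCommGroup H₁] [InnerProductSpace ℂ H₁] [CompleteSpace H₁]
  [NormedAddCommGroup H₂] [InnerProductSpace ℂ H₂] [CompleteSpace H₂]

/-- On the span of the generalised eigenspaces of `A*A` with `|μ| ≥ t` one has
`t ‖x‖² ≤ ‖A x‖²`. -/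
theorem mul_sq_norm_le_of_mem_iSup_maxGenEigenspace (A : H₁ →L[ℂ] H₂) (t : ℝ) {x : H₁}
    (hx : x ∈ (⨆ μ ∈ {μ : ℂ | t ≤ ‖μ‖}, Module.End.maxGenEigenspace
      ((ContinuousLinearMap.adjoint A ∘L A : H₁ →L[ℂ] H₁) : Module.End ℂ H₁) μ :
      Submodule ℂ H₁)) : t * ‖x‖ ^ 2 ≤ ‖A x‖ ^ 2 := by
  classical
  set T : H₁ →L[ℂ] H₁ := ContinuousLinearMap.adjoint A ∘L A with hT
  have hinner : ∀ y z : H₁, inner ℂ (T y) z = inner ℂ (A y) (A z) := by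
    intro y z
    rw [hT, ContinuousLinearMap.comp_apply, ContinuousLinearMap.adjoint_inner_left]
  have hsym : (T : Module.End ℂ H₁).IsSymmetric := by
    intro y z
    change inner ℂ (T y) z = inner ℂ y (T z)
    rw [hinner, ← inner_conj_symm y, hinner, inner_conj_symm]
  -- A symmetric operator has no Jordan blocks, so `x` is a finite sum of pairwise orthogonal
  -- eigenvectors, and the claim can be checked on each of them.
  simp only [hsym.isFinitelySemisimple.maxGenEigenspace_eq_eigenspace] at hx
  rw [iSup_subtype'] at hx
  obtain ⟨f, hf⟩ := (Submodule.mem_iSup_iff_exists_dfinsupp' _ _).1 hx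
  have hO := hsym.orthogonalFamily_eigenspaces.comp
    (Subtype.coe_injective (p := fun μ : ℂ => μ ∈ {μ : ℂ | t ≤ ‖μ‖}))
  have hTv : ∀ (i : {μ : ℂ // μ ∈ {μ : ℂ | t ≤ ‖μ‖}}), T (f i : H₁) = (i : ℂ) • (f i : H₁) :=
    fun i => Module.End.mem_eigenspace_iff.1 (f i).2
  have hxs : x = ∑ i ∈ f.support, (f i : H₁) := by
    rw [← hf]; rfl
  have hTx : T x = ∑ i ∈ f.support, (((i : ℂ) • f i : Module.End.eigenspace
      (T : Module.End ℂ H₁) (i : ℂ)) : H₁) := by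
    rw [hxs, map_sum]
    exact Finset.sum_congr rfl fun i _ => hTv i
  have hnorm : ‖x‖ ^ 2 = ∑ i ∈ f.support, ‖(f i : H₁)‖ ^ 2 := by
    have := hO.norm_sum (fun i => f i) f.support
    simp only [Submodule.coe_subtypeₗᵢ, Submodule.coe_subtype] at this
    rw [hxs]; exact this
  have hA : ((‖A x‖ ^ 2 : ℝ) : ℂ) = ∑ i ∈ f.support, ((‖A (f i : H₁)‖ ^ 2 : ℝ) : ℂ) := by
    have h1 := hO.inner_sum (fun i => (i : ℂ) • f i) (fun i => f i) f.support
    simp only [Submodule.coe_subtypeₗᵢ, Submodule.coe_subtype] at h1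
    rw [← hTx, ← hxs, hinner, inner_self_eq_norm_sq_to_K] at h1
    push_cast
    refine h1.trans (Finset.sum_congr rfl fun i _ => ?_)
    have : inner ℂ (T (f i : H₁)) (f i : H₁) = ((‖A (f i : H₁)‖ : ℂ)) ^ 2 := by
      rw [hinner, inner_self_eq_norm_sq_to_K]; rfl
    rw [← this, hTv]; rfl
  have hA' : ‖A x‖ ^ 2 = ∑ i ∈ f.support, ‖A (f i : H₁)‖ ^ 2 := by exact_mod_cast hA
  rw [hnorm, hA', Finset.mul_sum]
  refine Finset.sum_le_sum fun i _ => ?_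
  have h2 : ‖A (f i : H₁)‖ ^ 2 = ‖(i : ℂ)‖ * ‖(f i : H₁)‖ ^ 2 := by
    have h3 : inner ℂ ((i : ℂ) • (f i : H₁)) (f i : H₁) = ((‖A (f i : H₁)‖ : ℂ)) ^ 2 := by
      rw [← hTv, hinner, inner_self_eq_norm_sq_to_K]; rfl
    have h4 := congrArg norm h3
    rw [inner_smul_left, inner_self_eq_norm_sq_to_K] at h4
    simpa using h4.symm
  rw [h2]
  have := i.2
  gcongr
  exact this

/-- A bound `‖A x‖ ≤ ε ‖x‖` on a subspace of codimension less than `n` bounds `s_n(A)`. -/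
theorem singularValue_le_of_norm_le_on_ker (A : H₁ →L[ℂ] H₂) {W : Type*} [AddCommGroup W]
    [Module ℂ W] [FiniteDimensional ℂ W] (Φ : H₁ →ₗ[ℂ] W) {n : ℕ}
    (hn : Module.finrank ℂ W < n) {ε : ℝ} (hε : 0 ≤ ε)
    (h : ∀ x, Φ x = 0 → ‖A x‖ ≤ ε * ‖x‖) : singularValue A n ≤ ε := by
  refine Real.sqrt_le_iff.2 ⟨hε, Real.sSup_le ?_ (by positivity)⟩
  rintro t ⟨-, ht⟩
  set U := (⨆ μ ∈ {μ : ℂ | t ≤ ‖μ‖}, Module.End.maxGenEigenspace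
      ((ContinuousLinearMap.adjoint A ∘L A : H₁ →L[ℂ] H₁) : Module.End ℂ H₁) μ :
      Submodule ℂ H₁)
  -- The spectral subspace may have infinite rank, so `n` independent vectors are chosen in it; some
  -- nontrivial combination of them is killed by `Φ`.
  obtain ⟨v, hv⟩ := exists_linearIndependent_of_le_rank ht
  have hlt : Module.finrank ℂ W < Module.finrank ℂ (Fin n → ℂ) := by simpa using hn
  obtain ⟨c, hc, hc0⟩ := Submodule.exists_mem_ne_zero_of_ne_bot
    (LinearMap.ker_ne_bot_of_finrank_lt (f := Φ ∘ₗ U.subtype ∘ₗ Fintype.linearCombination ℂ v) hlt)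
  set y : U := Fintype.linearCombination ℂ v c with hy
  have hy0 : y ≠ 0 := by
    intro h0
    apply hc0
    exact hv.fintypeLinearCombination_injective (by rw [map_zero]; exact h0)
  have h1 := mul_sq_norm_le_of_mem_iSup_maxGenEigenspace A t y.2
  have h2 := h y hc
  have hpos : 0 < ‖(y : H₁)‖ := norm_pos_iff.2 (by simpa using hy0)
  have h3 : t * ‖(y : H₁)‖ ^ 2 ≤ ε ^ 2 * ‖(y : H₁)‖ ^ 2 := by
    rw [← mul_pow]
    exact h1.trans (by gcongr)
  exact le_of_mul_le_mul_right h3 (by positivity)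

/-- An operator which is arbitrarily small on subspaces of finite codimension is compact. -/
theorem isCompactOperator_of_forall_exists_norm_le_on_ker (A : H₁ →L[ℂ] H₂)
    (h : ∀ ε > 0, ∃ m : ℕ, ∃ Φ : H₁ →ₗ[ℂ] (Fin m → ℂ),
      ∀ x, Φ x = 0 → ‖A x‖ ≤ ε * ‖x‖) : IsCompactOperator A := by
  refine (isClosed_setOfPred_isCompactOperator (σ₁₂ := RingHom.id ℂ) (M₁ := H₁) (M₂ := H₂)).closure_subset (Metric.mem_closure_iff.2 fun ε hε => ?_)
  obtain ⟨m, Φ, hΦ⟩ := h (ε / 2) (half_pos hε)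
  -- `Φ` is not assumed continuous, so its kernel need not be closed. The bound survives closure,
  -- and `Φ` is still injective on the orthogonal complement.
  set M := Φ.ker.topologicalClosure with hM
  have hMc : IsClosed (M : Set H₁) := Submodule.isClosed_topologicalClosure _
  have : CompleteSpace M := hMc.completeSpace_coe
  have hbound : ∀ x ∈ M, ‖A x‖ ≤ ε / 2 * ‖x‖ := by
    have hcl : IsClosed {x : H₁ | ‖A x‖ ≤ ε / 2 * ‖x‖} :=
      isClosed_le (by fun_prop) (by fun_prop)
    intro x hx
    exact hcl.closure_subset_iff.2 (fun y hy => hΦ y hy) hx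
  have hfd : FiniteDimensional ℂ (Mᗮ : Submodule ℂ H₁) := by
    refine Module.Finite.of_injective (Φ ∘ₗ (Mᗮ).subtype) ?_
    rw [← LinearMap.ker_eq_bot, LinearMap.ker_eq_bot']
    intro x hx
    have hxM : (x : H₁) ∈ M := Submodule.le_topologicalClosure _ hx
    have := Submodule.inner_right_of_mem_orthogonal hxM x.2
    simpa using this
  -- A finite-rank approximation; the error is `A` composed with the projection onto `M`, where `A`
  -- has norm at most `ε / 2`.
  refine ⟨A ∘L (Mᗮ).starProjection, ?_, ?_⟩
  · have h1 : IsCompactOperator ((Mᗮ).orthogonalProjectionOnto) :=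
      have := FiniteDimensional.proper ℂ (Mᗮ : Submodule ℂ H₁)
      isCompactOperator_of_locallyCompactSpace_dom _
    exact h1.clm_comp (A ∘L (Mᗮ).subtypeL)
  · rw [dist_eq_norm]
    refine lt_of_le_of_lt (ContinuousLinearMap.opNorm_le_bound _ (half_pos hε).le fun x => ?_)
      (half_lt_self hε)
    have h1 : x - (Mᗮ).starProjection x = M.starProjection x := by
      simp
    have h2 : (A - A ∘L (Mᗮ).starProjection) x = A (M.starProjection x) := by
      rw [← h1]; simp
    rw [h2]
    refine (hbound _ (Submodule.starProjection_apply_mem _ _)).trans ?_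
    gcongr
    exact Submodule.norm_starProjection_apply_le _ _

end SingularValues

/-! ### Schwarz lemma, partial derivatives and Taylor coefficients in several variables. -/

section SeveralVariables

open Asymptotics

/-- The Schwarz lemma for functions vanishing to order `K` at the origin. -/
theorem norm_le_mul_div_pow_of_isBigO {h : ℂ → ℂ} {R B : ℝ} {K : ℕ}
    (hd : DifferentiableOn ℂ h (Metric.ball 0 R)) (hB : ∀ z ∈ Metric.ball (0 : ℂ) R, ‖h z‖ ≤ B)
    (hO : h =O[𝓝 0] fun z => z ^ K) {z : ℂ} (hz : z ∈ Metric.ball (0 : ℂ) R) :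
    ‖h z‖ ≤ B * (‖z‖ / R) ^ K := by
  rcases K with _ | K
  · simpa using hB z hz
  have h0 : h 0 = 0 := by
    have := hO.eq_zero_imp
    simpa using this.self_of_nhds (by simp)
  -- The one-variable Schwarz lemma turns `o(|w|^K)` into the exponent `K + 1`; this shift is why
  -- order zero was split off.
  have ho : (fun w => h w - h 0) =o[𝓝 0] fun w : ℂ => ‖w - 0‖ ^ K := by
    simp only [h0, sub_zero]
    have h1 : (fun w : ℂ => w ^ (K + 1)) =o[𝓝 0] fun w : ℂ => w ^ K :=
      isLittleO_pow_pow (Nat.lt_succ_self K)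
    have h2 := (hO.trans_isLittleO h1).norm_right
    simpa [norm_pow] using h2
  have hmaps : MapsTo h (Metric.ball 0 R) (Metric.closedBall (h 0) B) := by
    intro w hw
    rw [h0, mem_closedBall_zero_iff]
    exact hB w hw
  have := Complex.dist_le_mul_div_pow_of_mapsTo_ball_of_isLittleO hd hmaps ho hz
  simpa [h0] using this

variable {d : ℕ}

theorem hasDerivAt_comp_add_smul {f : Cn d → ℂ} {Ω : Set (Cn d)} (hΩ : IsOpen Ω)
    (hf : DifferentiableOn ℂ f Ω) {y v : Cn d} {ζ : ℂ} (h : y + ζ • v ∈ Ω) :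
    HasDerivAt (fun z : ℂ => f (y + z • v)) (fderiv ℂ f (y + ζ • v) v) ζ := by
  have h1 : HasFDerivAt f (fderiv ℂ f (y + ζ • v)) (y + ζ • v) :=
    (hf.differentiableAt (hΩ.mem_nhds h)).hasFDerivAt
  have h2 : HasDerivAt (fun z : ℂ => y + z • v) v ζ := by
    simpa using ((hasDerivAt_id ζ).smul_const v).const_add y
  exact h1.comp_hasDerivAt ζ h2

/-- The directional derivatives of a holomorphic function of several variables are holomorphic. -/
theorem differentiableOn_fderiv_apply {f : Cn d → ℂ} {Ω : Set (Cn d)} (hΩ : IsOpen Ω)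
    (hf : DifferentiableOn ℂ f Ω) (v : Cn d) :
    DifferentiableOn ℂ (fun y => fderiv ℂ f y v) Ω := by
  intro z hz
  apply DifferentiableAt.differentiableWithinAt
  obtain ⟨R, hR, B, hball, hB⟩ : ∃ R > 0, ∃ B : ℝ, Metric.ball z R ⊆ Ω ∧
      ∀ x ∈ Metric.ball z R, ‖f x‖ ≤ B := by
    have h1 : ∀ᶠ x in 𝓝 z, ‖f x‖ < ‖f z‖ + 1 :=
      (hf.differentiableAt (hΩ.mem_nhds hz)).continuousAt.norm.eventually
        (gt_mem_nhds (lt_add_one _))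
    obtain ⟨R, hR, h⟩ := Metric.mem_nhds_iff.1 (inter_mem h1 (hΩ.mem_nhds hz))
    exact ⟨R, hR, ‖f z‖ + 1, fun x hx => (h hx).2, fun x hx => (h hx).1.le⟩
  have hB0 : 0 ≤ B := (norm_nonneg _).trans (hB z (Metric.mem_ball_self hR))
  -- Small enough that points within `R / 2` of `z`, moved by `ζ • v` with `|ζ| < s`, stay in the
  -- ball where `|f| ≤ B`.
  set s : ℝ := R / (2 * (‖v‖ + 1)) with hs
  have hs0 : 0 < s := by positivity
  have hsv : s * ‖v‖ ≤ R / 2 := by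
    rw [hs, div_mul_eq_mul_div, div_le_div_iff₀ (by positivity) two_pos]
    nlinarith [norm_nonneg v]
  have hmem : ∀ y ∈ Metric.ball z (R / 4 + R / 4), ∀ ζ ∈ Metric.ball (0 : ℂ) s,
      y + ζ • v ∈ Metric.ball z R := by
    intro y hy ζ hζ
    rw [Metric.mem_ball, dist_eq_norm] at hy ⊢
    have hζ' : ‖ζ‖ ≤ s := (mem_ball_zero_iff.1 hζ).le
    calc ‖y + ζ • v - z‖ = ‖(y - z) + ζ • v‖ := by congr 1; abel
      _ ≤ ‖y - z‖ + ‖ζ‖ * ‖v‖ := (norm_add_le _ _).trans_eq (by rw [norm_smul])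
      _ ≤ ‖y - z‖ + s * ‖v‖ := by gcongr
      _ < R := by linarith
  set g : Cn d → ℂ → ℂ := fun y ζ => f (y + ζ • v) with hg
  have hgd : ∀ y ∈ Metric.ball z (R / 4 + R / 4), DifferentiableOn ℂ (g y) (Metric.ball 0 s) :=
    fun y hy ζ hζ => (hasDerivAt_comp_add_smul hΩ hf
      (hball (hmem y hy ζ hζ))).differentiableAt.differentiableWithinAt
  -- The Schwarz lemma twice: once to bound the difference quotient, once to bound its deviation
  -- from its value at `0`. The rate is uniform in `y`, so the derivative is a locally uniform limit
  -- of holomorphic difference quotients.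
  have hslope : ∀ y ∈ Metric.ball z (R / 4 + R / 4), ∀ ζ ∈ Metric.ball (0 : ℂ) s,
      ‖dslope (g y) 0 ζ - fderiv ℂ f y v‖ ≤ 2 * (2 * B / s) / s * ‖ζ‖ := by
    intro y hy ζ hζ
    have h0 : (0 : ℂ) ∈ Metric.ball (0 : ℂ) s := Metric.mem_ball_self hs0
    have hm1 : MapsTo (g y) (Metric.ball 0 s) (Metric.closedBall (g y 0) (2 * B)) := by
      intro w hw
      rw [mem_closedBall_iff_norm]
      refine (norm_sub_le _ _).trans ?_
      linarith [hB _ (hmem y hy w hw), hB _ (hmem y hy 0 h0)]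
    have hb : ∀ w ∈ Metric.ball (0 : ℂ) s, ‖dslope (g y) 0 w‖ ≤ 2 * B / s :=
      fun w hw => Complex.norm_dslope_le_div_of_mapsTo_ball (hgd y hy) hm1 hw
    have hm2 : MapsTo (dslope (g y) 0) (Metric.ball 0 s)
        (Metric.closedBall (dslope (g y) 0 0) (2 * (2 * B / s))) := by
      intro w hw
      rw [mem_closedBall_iff_norm]
      refine (norm_sub_le _ _).trans ?_
      linarith [hb w hw, hb 0 h0]
    have h := Complex.dist_le_div_mul_dist_of_mapsTo_ball
      ((Complex.differentiableOn_dslope (Metric.ball_mem_nhds _ hs0)).2 (hgd y hy)) hm2 hζ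
    have hder : deriv (g y) 0 = fderiv ℂ f y v := by
      have := (hasDerivAt_comp_add_smul hΩ hf (y := y) (v := v) (ζ := 0)
        (hball (hmem y hy 0 h0))).deriv
      simpa using this
    rwa [dslope_same, hder, dist_eq_norm, dist_zero_right] at h
  obtain ⟨n₀, hn₀⟩ := exists_nat_one_div_lt hs0
  set τ : ℕ → ℂ := fun n => 1 / ((n + n₀ : ℕ) + 1 : ℂ) with hτ
  have hτn : ∀ n, ‖τ n‖ = 1 / ((n + n₀ : ℕ) + 1 : ℝ) := by
    intro n
    rw [hτ, norm_div, norm_one]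
    congr 1
    exact_mod_cast Complex.norm_natCast (n + n₀ + 1)
  have hτ0 : Tendsto (fun n => ‖τ n‖) atTop (𝓝 0) := by
    simp_rw [hτn]
    exact (tendsto_one_div_add_atTop_nhds_zero_nat (𝕜 := ℝ)).comp (tendsto_add_atTop_nat n₀)
  have hτs : ∀ n, τ n ∈ Metric.ball (0 : ℂ) s := by
    intro n
    rw [mem_ball_zero_iff, hτn]
    refine lt_of_le_of_lt ?_ hn₀
    gcongr
    simp
  have hτne : ∀ n, τ n ≠ 0 := fun n => norm_pos_iff.1 (by rw [hτn]; positivity)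
  set C := 2 * (2 * B / s) / s with hC
  have hC0 : 0 ≤ C := by positivity
  have hτC : Tendsto (fun n => C * ‖τ n‖) atTop (𝓝 0) := by simpa using hτ0.const_mul C
  have hbase : ∀ x ∈ Metric.ball z (R / 4 + R / 4), x ∈ Ω := fun x hx =>
    hball (Metric.ball_subset_ball (by linarith) hx)
  refine weierstrass (r := R / 4) (F := fun n y => dslope (g y) 0 (τ n)) (by positivity) ?_ ?_ ?_
  · intro n
    have h1 : ∀ y, dslope (g y) 0 (τ n) = (τ n)⁻¹ • (f (y + τ n • v) - f y) := by
      intro y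
      rw [dslope_of_ne _ (hτne n), slope_def_module]
      simp [hg]
    simp only [h1]
    intro y hy
    have h2 : DifferentiableAt ℂ f (y + τ n • v) :=
      hf.differentiableAt (hΩ.mem_nhds (hball (hmem y hy _ (hτs n))))
    have h3 : DifferentiableAt ℂ f y := hf.differentiableAt (hΩ.mem_nhds (hbase y hy))
    have h4 : DifferentiableAt ℂ (fun y => f (y + τ n • v)) y :=
      h2.comp y (by fun_prop : DifferentiableAt ℂ (fun y => y + τ n • v) y)
    exact ((h4.fun_sub h3).fun_const_smul _).differentiableWithinAt
  · intro ε hε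
    obtain ⟨N, hN⟩ := (hτC.eventually (gt_mem_nhds (half_pos hε))).exists_forall_of_atTop
    refine ⟨N, fun m hm n hn x hx => ?_⟩
    have h1 := (hslope x hx _ (hτs m)).trans (hN m hm).le
    have h2 := (hslope x hx _ (hτs n)).trans (hN n hn).le
    calc _ = ‖(dslope (g x) 0 (τ m) - fderiv ℂ f x v) -
          (dslope (g x) 0 (τ n) - fderiv ℂ f x v)‖ := by congr 1; abel
      _ ≤ ε := (norm_sub_le _ _).trans (by linarith)
  · intro x hx
    rw [tendsto_iff_norm_sub_tendsto_zero]
    exact squeeze_zero (fun _ => norm_nonneg _) (fun n => hslope x hx _ (hτs n)) hτC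

/-- The homogeneous monomial `u ↦ ∏ i, u_i ^ α_i`. -/
noncomputable def monomialFun (α : Fin d → ℕ) (u : Cn d) : ℂ := ∏ i, u i ^ α i

/-- The span of the monomials of degree `k`. -/
noncomputable def homogeneousSpan (d k : ℕ) : Submodule ℂ (Cn d → ℂ) :=
  Submodule.span ℂ {p | ∃ α : Fin d → ℕ, ∑ i, α i = k ∧ p = monomialFun α}

theorem coord_mul_mem_homogeneousSpan {k : ℕ} {p : Cn d → ℂ} (hp : p ∈ homogeneousSpan d k)
    (i : Fin d) : (fun u => u i * p u) ∈ homogeneousSpan d (k + 1) := by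
  classical
  have : homogeneousSpan d k ≤ (homogeneousSpan d (k + 1)).comap
      (LinearMap.mulLeft ℂ (fun u : Cn d => u i)) := by
    refine Submodule.span_le.2 ?_
    rintro _ ⟨α, hα, rfl⟩
    refine Submodule.subset_span ⟨α + Pi.single i 1, ?_, ?_⟩
    · simp [Finset.sum_add_distrib, hα]
    · funext u
      simp only [LinearMap.mulLeft_apply, Pi.mul_apply, monomialFun, Pi.add_apply, pow_add,
        Finset.prod_mul_distrib]
      rw [mul_comm]
      congr 1
      rw [Finset.prod_eq_single i] <;> simp +contextual
  exact this hp

/-- The Taylor coefficients of the slices of a holomorphic function are homogeneous polynomials. -/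
theorem iteratedDeriv_slice_mem_homogeneousSpan {Ω : Set (Cn d)} (hΩ : IsOpen Ω) {c : Cn d}
    (hc : c ∈ Ω) (k : ℕ) : ∀ f : Cn d → ℂ, DifferentiableOn ℂ f Ω →
    (fun u : Cn d => iteratedDeriv k (fun ζ : ℂ => f (c + ζ • u)) 0) ∈ homogeneousSpan d k := by
  induction k with
  | zero =>
    intro f _
    have : (fun u : Cn d => iteratedDeriv 0 (fun ζ : ℂ => f (c + ζ • u)) 0) =
        f c • monomialFun (d := d) 0 := by
      funext u; simp [monomialFun]
    rw [this]
    exact Submodule.smul_mem _ _ (Submodule.subset_span ⟨0, by simp, rfl⟩)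
  | succ k ih =>
    intro f hf
    have hpd := fun i : Fin d => differentiableOn_fderiv_apply hΩ hf (EuclideanSpace.single i 1)
    have hsl : ∀ (g : Cn d → ℂ), DifferentiableOn ℂ g Ω → ∀ u : Cn d,
        ContDiffAt ℂ k (fun ζ : ℂ => g (c + ζ • u)) 0 := by
      intro g hgd u
      refine (DifferentiableOn.analyticAt (s := {ζ : ℂ | c + ζ • u ∈ Ω}) ?_ ?_).contDiffAt
      · exact fun ζ hζ => (hasDerivAt_comp_add_smul hΩ hgd hζ).differentiableAt.differentiableWithinAt
      · exact (hΩ.preimage (by fun_prop)).mem_nhds (by simpa using hc)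
    -- By the chain rule the slice has derivative `∑ u_i ∂_i f(c + ζu)`. The induction hypothesis is
    -- applied to the partial derivatives, hence the quantifier over `f`.
    have key : (fun u : Cn d => iteratedDeriv (k + 1) (fun ζ : ℂ => f (c + ζ • u)) 0) =
        ∑ i, fun u : Cn d => u i * iteratedDeriv k
          (fun ζ : ℂ => fderiv ℂ f (c + ζ • u) (EuclideanSpace.single i 1)) 0 := by
      funext u
      rw [iteratedDeriv_succ', Finset.sum_apply]
      have hev : deriv (fun ζ : ℂ => f (c + ζ • u)) =ᶠ[𝓝 0]
          fun ζ => ∑ i, u i * fderiv ℂ f (c + ζ • u) (EuclideanSpace.single i 1) := by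
        have : ∀ᶠ ζ : ℂ in 𝓝 0, c + ζ • u ∈ Ω :=
          (hΩ.preimage (by fun_prop : Continuous fun ζ : ℂ => c + ζ • u)).mem_nhds
            (by simpa using hc)
        filter_upwards [this] with ζ hζ
        rw [(hasDerivAt_comp_add_smul hΩ hf hζ).deriv]
        conv_lhs => arg 2; rw [← (EuclideanSpace.basisFun (Fin d) ℂ).sum_repr u]
        simp [map_sum]
      rw [hev.iteratedDeriv_eq, iteratedDeriv_fun_sum]
      · exact Finset.sum_congr rfl fun i _ => iteratedDeriv_const_mul_field _ _
      · exact fun i _ => contDiffAt_const.mul (hsl _ (hpd i) u)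
    rw [key]
    exact Submodule.sum_mem _ fun i _ => coord_mul_mem_homogeneousSpan (ih _ (hpd i)) i

end SeveralVariables

/-! ### Taylor polynomials and vanishing to order `K`. -/

section Taylor

open Asymptotics

variable {d : ℕ}

namespace Bergman

variable {Ω : TopologicalSpace.Opens (Cn d)}

theorem eqOn_add (F G : Bergman Ω) : EqOn (F + G).toFun (F.toFun + G.toFun) Ω := by
  refine eqOn_toFun _ (F.differentiableOn.add G.differentiableOn) ?_
  exact (Lp.coeFn_add (F : Lp ℂ 2 ((normVol d).restrict (Ω : Set (Cn d)))) G).trans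
    (F.ae_eq.add G.ae_eq)

theorem eqOn_smul (a : ℂ) (F : Bergman Ω) : EqOn (a • F).toFun (a • F.toFun) Ω := by
  refine eqOn_toFun _ (F.differentiableOn.const_smul a) ?_
  exact (Lp.coeFn_smul a (F : Lp ℂ 2 ((normVol d).restrict (Ω : Set (Cn d))))).trans
    (F.ae_eq.const_smul a)

end Bergman

theorem analyticAt_slice {f : Cn d → ℂ} {Ω : Set (Cn d)} (hΩ : IsOpen Ω)
    (hf : DifferentiableOn ℂ f Ω) {c : Cn d} (hc : c ∈ Ω) (u : Cn d) :
    AnalyticAt ℂ (fun ζ : ℂ => f (c + ζ • u)) 0 := by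
  refine DifferentiableOn.analyticAt (s := {ζ : ℂ | c + ζ • u ∈ Ω}) ?_ ?_
  · exact fun ζ hζ => (hasDerivAt_comp_add_smul hΩ hf hζ).differentiableAt.differentiableWithinAt
  · exact (hΩ.preimage (by fun_prop : Continuous fun ζ : ℂ => c + ζ • u)).mem_nhds
      (by simpa using hc)

theorem slice_eventuallyEq {f g : Cn d → ℂ} {Ω : Set (Cn d)} (hΩ : IsOpen Ω)
    (hfg : EqOn f g Ω) {c : Cn d} (hc : c ∈ Ω) (u : Cn d) :
    (fun ζ : ℂ => f (c + ζ • u)) =ᶠ[𝓝 0] fun ζ : ℂ => g (c + ζ • u) := by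
  have : ∀ᶠ ζ : ℂ in 𝓝 0, c + ζ • u ∈ Ω :=
    (hΩ.preimage (by fun_prop : Continuous fun ζ : ℂ => c + ζ • u)).mem_nhds (by simpa using hc)
  filter_upwards [this] with ζ hζ using hfg hζ

theorem homogeneousSpan_apply_smul {k : ℕ} {p : Cn d → ℂ} (hp : p ∈ homogeneousSpan d k)
    (ζ : ℂ) (u : Cn d) : p (ζ • u) = ζ ^ k * p u := by
  induction hp using Submodule.span_induction with
  | mem p hp =>
    obtain ⟨α, hα, rfl⟩ := hp
    simp [monomialFun, mul_pow, Finset.prod_mul_distrib, Finset.prod_pow_eq_pow_sum, hα]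
  | zero => simp
  | add p q _ _ hp hq => simp [hp, hq, mul_add]
  | smul a p _ hp => simp [hp]; ring

/-- The span of the monomials whose exponents are all less than `K`. -/
noncomputable def boxSpan (d K : ℕ) : Submodule ℂ (Cn d → ℂ) :=
  Submodule.span ℂ (range fun α : Fin d → Fin K => monomialFun fun i => (α i : ℕ))

instance (d K : ℕ) : FiniteDimensional ℂ (boxSpan d K) :=
  FiniteDimensional.span_of_finite ℂ (finite_range _)

/-- Polynomials of degree below `K` are placed in a box of exponents, whose size `K ^ d` is the
count that the constant `c` is tuned to. -/
theorem finrank_boxSpan_le (d K : ℕ) : Module.finrank ℂ (boxSpan d K) ≤ K ^ d := by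
  refine (finrank_range_le_card _).trans ?_
  simp

theorem homogeneousSpan_le_boxSpan {k K : ℕ} (h : k < K) :
    homogeneousSpan d k ≤ boxSpan d K := by
  refine Submodule.span_le.2 ?_
  rintro _ ⟨α, hα, rfl⟩
  have hlt : ∀ i, α i < K := fun i =>
    (Finset.single_le_sum (fun j _ => Nat.zero_le (α j)) (Finset.mem_univ i)).trans_lt
      (hα.trans_lt h)
  exact Submodule.subset_span ⟨fun i => ⟨α i, hlt i⟩, rfl⟩

/-- A linear map into a space of dimension at most `K ^ d` whose kernel consists of functions
vanishing at `c` to order `K` along all complex lines through `c`. -/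
theorem exists_linearMap_ker_vanishing (Ω : TopologicalSpace.Opens (Cn d)) {c : Cn d}
    (hc : c ∈ Ω) (K : ℕ) : ∃ Φ : Bergman Ω →ₗ[ℂ] boxSpan d K, ∀ f : Bergman Ω, Φ f = 0 →
      ∀ u : Cn d, (fun ζ : ℂ => f (c + ζ • u)) =O[𝓝 0] fun ζ : ℂ => ζ ^ K := by
  have hcΩ : c ∈ (Ω : Set (Cn d)) := hc
  -- The Taylor polynomial of degree below `K` at `c`, assembled from one-variable Taylor
  -- coefficients of slices.
  let Ψ : Bergman Ω →ₗ[ℂ] (Cn d → ℂ) :=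
    { toFun := fun f u => ∑ k ∈ Finset.range K,
        (k.factorial : ℂ)⁻¹ * iteratedDeriv k (fun ζ : ℂ => f (c + ζ • u)) 0
      map_add' := fun f g => by
        funext u
        rw [Pi.add_apply, ← Finset.sum_add_distrib]
        refine Finset.sum_congr rfl fun k _ => ?_
        rw [← mul_add, (slice_eventuallyEq Ω.isOpen (f.eqOn_add g) hcΩ u).iteratedDeriv_eq]
        congr 1
        exact iteratedDeriv_fun_add
          (analyticAt_slice Ω.isOpen f.differentiableOn hcΩ u).contDiffAt
          (analyticAt_slice Ω.isOpen g.differentiableOn hcΩ u).contDiffAt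
      map_smul' := fun a f => by
        funext u
        rw [Pi.smul_apply, smul_eq_mul, Finset.mul_sum]
        refine Finset.sum_congr rfl fun k _ => ?_
        rw [(slice_eventuallyEq Ω.isOpen (Bergman.eqOn_smul a f) hcΩ u).iteratedDeriv_eq]
        simp only [Pi.smul_apply, smul_eq_mul, RingHom.id_apply]
        rw [iteratedDeriv_const_mul_field]
        ring }
  have hmem : ∀ f : Bergman Ω, ∀ k, (fun u : Cn d => iteratedDeriv k
      (fun ζ : ℂ => f (c + ζ • u)) 0) ∈ homogeneousSpan d k := fun f k =>
    iteratedDeriv_slice_mem_homogeneousSpan Ω.isOpen hcΩ k f f.differentiableOn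
  have hΨ : ∀ f, Ψ f ∈ boxSpan d K := by
    intro f
    have : Ψ f = ∑ k ∈ Finset.range K, (k.factorial : ℂ)⁻¹ •
        fun u : Cn d => iteratedDeriv k (fun ζ : ℂ => f (c + ζ • u)) 0 := by
      funext u
      simp [Ψ, Finset.sum_apply]
    rw [this]
    exact Submodule.sum_mem _ fun k hk => Submodule.smul_mem _ _
      (homogeneousSpan_le_boxSpan (Finset.mem_range.1 hk) (hmem f k))
  refine ⟨Ψ.codRestrict _ hΨ, fun f hf u => ?_⟩
  have hf0 : Ψ f = 0 := congrArg Subtype.val hf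
  have han := analyticAt_slice Ω.isOpen f.differentiableOn hcΩ u
  have h := han.hasFPowerSeriesAt.isBigO_sub_partialSum_pow K
  -- By homogeneity the Taylor sum of the slice along `u`, taken at `ζ`, is the value of `Ψ f` at `ζ
  -- • u`. Thus `Ψ f = 0` kills the Taylor sums of all slices at once.
  have hps : ∀ ζ : ℂ, (FormalMultilinearSeries.ofScalars ℂ (fun n =>
      iteratedDeriv n (fun ζ : ℂ => f (c + ζ • u)) 0 / (n.factorial : ℂ))).partialSum K ζ = 0 := by
    intro ζ
    have h1 := congrFun hf0 (ζ • u)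
    refine Eq.trans ?_ h1
    rw [FormalMultilinearSeries.partialSum]
    refine Finset.sum_congr rfl fun k _ => ?_
    have h2 := homogeneousSpan_apply_smul (hmem f k) ζ u
    beta_reduce at h2
    rw [h2, FormalMultilinearSeries.ofScalars_apply_eq, smul_eq_mul, div_eq_inv_mul]
    ring
  simp only [hps, zero_add, sub_zero] at h
  refine (h.trans ?_)
  exact (isBigO_refl (fun ζ : ℂ => ζ ^ K) (𝓝 0)).norm_left.congr_left fun ζ => by simp

end Taylor

/-! ### Circled sets centred at the origin and the correlation integral. -/

section Circled

open Asymptotics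

variable {d : ℕ}

theorem finrank_real_Cn (d : ℕ) : Module.finrank ℝ (Cn d) = 2 * d := by
  rw [finrank_real_of_complex, finrank_euclideanSpace_fin]

/-- Write `ζ` as a unimodular factor times `|ζ|`: the rotation preserves the measure, the real
dilation scales it with real dimension `2d`. Both maps are homeomorphisms, so `g` need not be
measurable. -/
theorem lintegral_comp_complex_smul {ζ : ℂ} (hζ : ζ ≠ 0) (g : Cn d → ℝ≥0∞) :
    ∫⁻ u, g (ζ • u) ∂(normVol d) =
      ENNReal.ofReal ((‖ζ‖ ^ (2 * d))⁻¹) * ∫⁻ u, g u ∂(normVol d) := by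
  have hn : 0 < ‖ζ‖ := norm_pos_iff.2 hζ
  set c : ℂ := ζ / ‖ζ‖ with hc
  have hc1 : ‖c‖ = 1 := by simp [hc, hn.ne']
  have hζc : ∀ u : Cn d, ζ • u = c • ((‖ζ‖ : ℝ) • u) := by
    intro u
    rw [← Complex.coe_smul, smul_smul, hc, div_mul_cancel₀ _ (by exact_mod_cast hn.ne')]
  have hrot : ∀ g : Cn d → ℝ≥0∞, ∫⁻ u, g (c • u) ∂(normVol d) = ∫⁻ u, g u ∂(normVol d) := by
    intro g
    refine (rotE_measurePreserving c hc1).lintegral_comp_emb ?_ g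
    exact (Homeomorph.smulOfNeZero c (by rintro h; simp [h] at hc1)).measurableEmbedding
  have hscale := Measure.map_addHaar_smul (normVol d) hn.ne'
  have hemb : MeasurableEmbedding (fun u : Cn d => ‖ζ‖ • u) :=
    (Homeomorph.smulOfNeZero ‖ζ‖ hn.ne').measurableEmbedding
  simp_rw [hζc]
  rw [← hemb.lintegral_map (fun u => g (c • u))]
  have : (fun u : Cn d => ‖ζ‖ • u) = (‖ζ‖ • ·) := rfl
  rw [this, hscale, lintegral_smul_measure, hrot, finrank_real_Cn, smul_eq_mul,
    abs_of_pos (by positivity)]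

/-- Circled sets in the sense needed for dilations: an open set containing with `μ D` also the
compact closure of `μ D` for all `|μ| < 1`. -/
structure IsStrictlyBalanced (D : Set (Cn d)) : Prop where
  isOpen : IsOpen D
  isCompact_closure : ∀ μ : ℂ, ‖μ‖ < 1 → IsCompact (closure ((fun u => μ • u) '' D))
  closure_subset : ∀ μ : ℂ, ‖μ‖ < 1 → closure ((fun u => μ • u) '' D) ⊆ D

namespace IsStrictlyBalanced

variable {D : Set (Cn d)}

/-- The definition covers only `|μ| < 1`. For `|μ| = 1` openness helps: `(1 + t) u` is still in `D`
for some `t > 0`, and `μ / (1 + t)` has modulus below one. -/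
theorem smul_mem (hD : IsStrictlyBalanced D) {u : Cn d} (hu : u ∈ D) {μ : ℂ} (hμ : ‖μ‖ ≤ 1) :
    μ • u ∈ D := by
  have hcont : Continuous fun t : ℝ => ((1 + t : ℝ) : ℂ) • u := by fun_prop
  have hev : ∀ᶠ t : ℝ in 𝓝 0, ((1 + t : ℝ) : ℂ) • u ∈ D :=
    (hD.isOpen.preimage hcont).mem_nhds (by simpa using hu)
  obtain ⟨t, ht, ht0⟩ := ((hev.filter_mono nhdsWithin_le_nhds).and
    (self_mem_nhdsWithin : ∀ᶠ t : ℝ in 𝓝[>] 0, t ∈ Ioi (0 : ℝ))).exists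
  have ht0 : (0 : ℝ) < t := ht0
  have h1 : μ • u = (μ / ((1 + t : ℝ) : ℂ)) • (((1 + t : ℝ) : ℂ) • u) := by
    rw [smul_smul, div_mul_cancel₀]
    exact_mod_cast (by positivity : (1 + t : ℝ) ≠ 0)
  rw [h1]
  refine hD.closure_subset _ ?_ (subset_closure ⟨_, ht, rfl⟩)
  rw [norm_div, Complex.norm_real, Real.norm_of_nonneg (by positivity),
    div_lt_one (by positivity)]
  linarith

/-- Boundedness is hidden in the definition: half of `D` has compact closure, so doubling that
closure covers `D`. -/
theorem exists_isCompact_superset (hD : IsStrictlyBalanced D) : ∃ C, IsCompact C ∧ D ⊆ C := by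
  refine ⟨(fun u => (2 : ℂ) • u) '' closure ((fun u => (1 / 2 : ℂ) • u) '' D),
    (hD.isCompact_closure _ (by norm_num)).image (by fun_prop), fun u hu => ?_⟩
  exact ⟨(1 / 2 : ℂ) • u, subset_closure ⟨u, hu, rfl⟩, by simp [smul_smul]⟩

theorem measure_lt_top (hD : IsStrictlyBalanced D) : normVol d D < ∞ := by
  obtain ⟨C, hC, hDC⟩ := hD.exists_isCompact_superset
  exact (measure_mono hDC).trans_lt hC.measure_lt_top

/-- A function which is holomorphic on `γ D` is bounded on the smaller dilations of `D`. -/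
theorem exists_bound (hD : IsStrictlyBalanced D) {γ ρ : ℝ} (hρ : 0 < ρ) (hργ : ρ < γ)
    {f : Cn d → ℂ} (hf : ContinuousOn f ((fun u => (γ : ℂ) • u) '' D)) :
    ∃ B : ℝ, ∀ u ∈ D, ∀ ζ : ℂ, ‖ζ‖ ≤ ρ → ‖f (ζ • u)‖ ≤ B := by
  have hγ : 0 < γ := hρ.trans hργ
  have hlt : ‖((ρ / γ : ℝ) : ℂ)‖ < 1 := by
    rw [Complex.norm_real, Real.norm_of_nonneg (by positivity), div_lt_one hγ]
    exact hργ
  -- The closure of `(ρ/γ) D` is a compact subset of `D`, so its dilation by `γ` is compact in `γ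
  -- D`; it contains every `ζ • u = γ (ρ/γ) (ζ/ρ) u`.
  set C := (fun u : Cn d => (γ : ℂ) • u) '' closure ((fun u => ((ρ / γ : ℝ) : ℂ) • u) '' D)
  have hC : IsCompact C := (hD.isCompact_closure _ hlt).image (by fun_prop)
  have hCs : C ⊆ (fun u => (γ : ℂ) • u) '' D := image_mono (hD.closure_subset _ hlt)
  obtain ⟨B, hB⟩ := hC.exists_bound_of_continuousOn (hf.mono hCs)
  refine ⟨B, fun u hu ζ hζ => hB _ ⟨((ρ / γ : ℝ) : ℂ) • ((ζ / ρ) • u),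
    subset_closure ⟨_, hD.smul_mem hu ?_, rfl⟩, ?_⟩⟩
  · rw [norm_div, Complex.norm_real, Real.norm_of_nonneg hρ.le]
    exact div_le_one_of_le₀ hζ hρ.le
  · have h1 : (γ : ℂ) ≠ 0 := by exact_mod_cast hγ.ne'
    have h2 : (ρ : ℂ) ≠ 0 := by exact_mod_cast hρ.ne'
    simp only [smul_smul]
    congr 1
    push_cast
    field_simp

theorem smul_mem_dilate (hD : IsStrictlyBalanced D) {γ : ℝ} (hγ : 0 < γ) {u : Cn d} (hu : u ∈ D)
    {ζ : ℂ} (hζ : ‖ζ‖ ≤ γ) : ζ • u ∈ (fun u => (γ : ℂ) • u) '' D := by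
  refine ⟨(ζ / γ) • u, hD.smul_mem hu ?_, ?_⟩
  · rw [norm_div, Complex.norm_real, Real.norm_of_nonneg hγ.le]
    exact div_le_one_of_le₀ hζ hγ.le
  · have h1 : (γ : ℂ) ≠ 0 := by exact_mod_cast hγ.ne'
    simp only [smul_smul]
    congr 1
    field_simp

theorem isOpen_dilate (hD : IsStrictlyBalanced D) {γ : ℝ} (hγ : 0 < γ) :
    IsOpen ((fun u => (γ : ℂ) • u) '' D) :=
  (Homeomorph.smulOfNeZero (γ : ℂ) (by exact_mod_cast hγ.ne')).isOpenMap _ hD.isOpen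

theorem hasDerivAt_slice (hD : IsStrictlyBalanced D) {γ : ℝ} (hγ : 0 < γ) {f : Cn d → ℂ}
    (hf : DifferentiableOn ℂ f ((fun u => (γ : ℂ) • u) '' D)) {u : Cn d} (hu : u ∈ D) {ζ : ℂ}
    (hζ : ‖ζ‖ ≤ γ) : HasDerivAt (fun z : ℂ => f (z • u)) (fderiv ℂ f (ζ • u) u) ζ := by
  have := hasDerivAt_comp_add_smul (hD.isOpen_dilate hγ) hf (y := 0) (v := u) (ζ := ζ)
    (by simpa using hD.smul_mem_dilate hγ hu hζ)
  simpa using this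

theorem continuousOn_comp_smul (hD : IsStrictlyBalanced D) {γ : ℝ} (hγ : 0 < γ) {f : Cn d → ℂ}
    (hf : ContinuousOn f ((fun u => (γ : ℂ) • u) '' D)) {ζ : ℂ} (hζ : ‖ζ‖ ≤ γ) :
    ContinuousOn (fun u => f (ζ • u)) D :=
  hf.comp (by fun_prop) fun _ hu => hD.smul_mem_dilate hγ hu hζ

/-- The correlation `ζ ↦ ∫_D f(ζ u) \overline{f(u)} dV(u)` is holomorphic. -/
theorem differentiableOn_correlation (hD : IsStrictlyBalanced D) {γ ρ : ℝ} (hρ : 1 < ρ)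
    (hργ : ρ < γ) {f : Cn d → ℂ} (hf : DifferentiableOn ℂ f ((fun u => (γ : ℂ) • u) '' D)) :
    DifferentiableOn ℂ (fun ζ : ℂ => ∫ u in D, f (ζ • u) * (starRingEnd ℂ) (f u) ∂(normVol d))
      (Metric.ball 0 ρ) := by
  have hρ0 : 0 < ρ := one_pos.trans hρ
  have hγ : 0 < γ := hρ0.trans hργ
  obtain ⟨B, hB⟩ := hD.exists_bound hρ0 hργ hf.continuousOn
  have : IsFiniteMeasure ((normVol d).restrict D) :=
    ⟨by rw [Measure.restrict_apply_univ]; exact hD.measure_lt_top⟩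
  have hmD : MeasurableSet D := hD.isOpen.measurableSet
  have hf1 : ContinuousOn (fun u => (starRingEnd ℂ) (f u)) D := by
    have := hD.continuousOn_comp_smul hγ hf.continuousOn (ζ := 1) (by simp; linarith)
    simp only [one_smul] at this
    exact Complex.continuous_conj.comp_continuousOn this
  have hcont : ∀ ζ : ℂ, ‖ζ‖ ≤ γ →
      ContinuousOn (fun u => f (ζ • u) * (starRingEnd ℂ) (f u)) D := fun ζ hζ =>
    (hD.continuousOn_comp_smul hγ hf.continuousOn hζ).mul hf1
  have hnorm1 : ∀ u ∈ D, ‖(starRingEnd ℂ) (f u)‖ ≤ B := by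
    intro u hu
    rw [RCLike.norm_conj]
    simpa using hB u hu 1 (by simpa using hρ.le)
  intro ζ₀ hζ₀
  have hζ₀' : ‖ζ₀‖ < ρ := mem_ball_zero_iff.1 hζ₀
  -- Half the gap, so discs of radius `ε` about points within `ε` of `ζ₀` stay in `|ζ| ≤ ρ`.
  -- Cauchy's estimate on them yields the constant dominating function.
  set ε : ℝ := (ρ - ‖ζ₀‖) / 2 with hε
  have hε0 : 0 < ε := by rw [hε]; linarith
  have hnear : ∀ x ∈ Metric.ball ζ₀ ε, ∀ y ∈ Metric.ball x ε, ‖y‖ ≤ ρ := by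
    intro x hx y hy
    rw [mem_ball_iff_norm] at hx hy
    have h1 : ‖y‖ ≤ ‖y - x‖ + ‖x - ζ₀‖ + ‖ζ₀‖ := by
      calc ‖y‖ = ‖(y - x) + (x - ζ₀) + ζ₀‖ := by congr 1; ring
        _ ≤ _ := norm_add₃_le
    linarith
  have hx_le : ∀ x ∈ Metric.ball ζ₀ ε, ‖x‖ ≤ ρ := fun x hx =>
    hnear x hx x (Metric.mem_ball_self hε0)
  refine (hasDerivAt_integral_of_dominated_loc_of_deriv_le (s := Metric.ball ζ₀ ε)
    (F' := fun ζ u => fderiv ℂ f (ζ • u) u * (starRingEnd ℂ) (f u))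
    (bound := fun _ => 2 * B / ε * B) (Metric.ball_mem_nhds _ hε0) ?_ ?_ ?_ ?_ ?_ ?_
    ).2.differentiableAt.differentiableWithinAt
  · filter_upwards [Metric.ball_mem_nhds ζ₀ hε0] with x hx
    exact (hcont x ((hx_le x hx).trans hργ.le)).aestronglyMeasurable hmD
  · refine Integrable.of_bound ((hcont ζ₀ (by linarith)).aestronglyMeasurable hmD) (B * B) ?_
    filter_upwards [ae_restrict_mem hmD] with u hu
    rw [norm_mul]
    have := hB u hu ζ₀ hζ₀'.le
    exact mul_le_mul this (hnorm1 u hu) (norm_nonneg _) ((norm_nonneg _).trans this)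
  · have h1 : ∀ u, fderiv ℂ f (ζ₀ • u) u =
        ∑ i, u i * fderiv ℂ f (ζ₀ • u) (EuclideanSpace.single i 1) := by
      intro u
      conv_lhs => arg 2; rw [← (EuclideanSpace.basisFun (Fin d) ℂ).sum_repr u]
      simp [map_sum]
    refine ContinuousOn.aestronglyMeasurable ?_ hmD
    refine ContinuousOn.mul ?_ hf1
    simp only [h1]
    refine continuousOn_finsetSum _ fun i _ => ContinuousOn.mul (by fun_prop) ?_
    exact hD.continuousOn_comp_smul hγ
      (differentiableOn_fderiv_apply (hD.isOpen_dilate hγ) hf _).continuousOn (by linarith)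
  · filter_upwards [ae_restrict_mem hmD] with u hu x hx
    have hd := hD.hasDerivAt_slice hγ hf hu ((hx_le x hx).trans hργ.le)
    have h2 : ‖fderiv ℂ f (x • u) u‖ ≤ 2 * B / ε := by
      rw [← hd.deriv]
      refine Complex.norm_deriv_le_div_of_mapsTo_ball (c := x) ?_ ?_ hε0
      · exact fun y hy => (hD.hasDerivAt_slice hγ hf hu
          ((hnear x hx y hy).trans hργ.le)).differentiableAt.differentiableWithinAt
      · intro y hy
        rw [mem_closedBall_iff_norm]
        refine (norm_sub_le _ _).trans ?_
        linarith [hB u hu y (hnear x hx y hy), hB u hu x (hx_le x hx)]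
    rw [norm_mul]
    exact mul_le_mul h2 (hnorm1 u hu) (norm_nonneg _) ((norm_nonneg _).trans h2)
  · exact integrable_const _
  · filter_upwards [ae_restrict_mem hmD] with u hu x hx
    exact (hD.hasDerivAt_slice hγ hf hu ((hx_le x hx).trans hργ.le)).mul_const _

/-- Cauchy-Schwarz for the correlation. -/
theorem norm_correlation_le (hD : IsStrictlyBalanced D) {γ : ℝ} (hγ : 1 < γ) {f : Cn d → ℂ}
    (hf : DifferentiableOn ℂ f ((fun u => (γ : ℂ) • u) '' D)) {ζ : ℂ} (hζ : ‖ζ‖ ≤ γ)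
    (hζ0 : ζ ≠ 0) :
    ‖∫ u in D, f (ζ • u) * (starRingEnd ℂ) (f u) ∂(normVol d)‖ₑ ^ 2 ≤
      ENNReal.ofReal ((‖ζ‖ ^ (2 * d))⁻¹) *
        (∫⁻ u in (fun u => (γ : ℂ) • u) '' D, ‖f u‖ₑ ^ 2 ∂(normVol d)) *
        ∫⁻ u in D, ‖f u‖ₑ ^ 2 ∂(normVol d) := by
  have hγ0 : 0 < γ := one_pos.trans hγ
  have hmD : MeasurableSet D := hD.isOpen.measurableSet
  have hm1 : AEMeasurable (fun u => ‖f (ζ • u)‖ₑ) ((normVol d).restrict D) :=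
    ((hD.continuousOn_comp_smul hγ0 hf.continuousOn hζ).aestronglyMeasurable hmD).enorm
  have hm2 : AEMeasurable (fun u => ‖f u‖ₑ) ((normVol d).restrict D) := by
    have := ((hD.continuousOn_comp_smul hγ0 hf.continuousOn (ζ := 1)
      (by simpa using hγ.le)).aestronglyMeasurable hmD (μ := normVol d)).enorm
    simpa using this
  have hCS := ENNReal.lintegral_mul_le_Lp_mul_Lq ((normVol d).restrict D)
    Real.HolderConjugate.two_two hm1 hm2
  have h1 : ‖∫ u in D, f (ζ • u) * (starRingEnd ℂ) (f u) ∂(normVol d)‖ₑ ≤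
      ∫⁻ u in D, ((fun u => ‖f (ζ • u)‖ₑ) * fun u => ‖f u‖ₑ) u ∂(normVol d) := by
    refine (enorm_integral_le_lintegral_enorm _).trans_eq (lintegral_congr fun u => ?_)
    simp [enorm_mul]
  -- The substitution `u ↦ ζ • u` costs `|ζ|^{-2d}` and maps `D` into `γ D`. This Jacobian is the
  -- source of the extra `d` in the exponent `K + d`.
  have h2 : ∫⁻ u in D, ‖f (ζ • u)‖ₑ ^ 2 ∂(normVol d) ≤ ENNReal.ofReal ((‖ζ‖ ^ (2 * d))⁻¹) *
      ∫⁻ u in (fun u => (γ : ℂ) • u) '' D, ‖f u‖ₑ ^ 2 ∂(normVol d) := by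
    rw [← lintegral_indicator (hD.isOpen_dilate hγ0).measurableSet,
      ← lintegral_comp_complex_smul hζ0, ← lintegral_indicator hmD]
    refine lintegral_mono fun u => ?_
    by_cases hu : u ∈ D
    · rw [indicator_of_mem hu, indicator_of_mem (hD.smul_mem_dilate hγ0 hu hζ)]
    · rw [indicator_of_notMem hu]; exact zero_le
  calc _ ≤ ((∫⁻ u in D, ‖f (ζ • u)‖ₑ ^ (2 : ℝ) ∂(normVol d)) ^ (1 / 2 : ℝ) *
        (∫⁻ u in D, ‖f u‖ₑ ^ (2 : ℝ) ∂(normVol d)) ^ (1 / 2 : ℝ)) ^ 2 := by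
        gcongr
        exact h1.trans hCS
    _ = (∫⁻ u in D, ‖f (ζ • u)‖ₑ ^ 2 ∂(normVol d)) * ∫⁻ u in D, ‖f u‖ₑ ^ 2 ∂(normVol d) := by
        rw [mul_pow]
        simp only [← ENNReal.rpow_natCast, ← ENNReal.rpow_mul]
        norm_num
    _ ≤ _ := by gcongr

end IsStrictlyBalanced

end Circled

/-! ### Contraction of the `L²` norm from `D(γ)` to `D`. -/

section Dilation

open Asymptotics

variable {d : ℕ} {D : Set (Cn d)}

theorem IsStrictlyBalanced.lintegral_sq_ne_top (hD : IsStrictlyBalanced D) {γ : ℝ} (hγ : 1 < γ)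
    {f : Cn d → ℂ} (hf : ContinuousOn f ((fun u => (γ : ℂ) • u) '' D)) :
    ∫⁻ u in D, ‖f u‖ₑ ^ 2 ∂(normVol d) ≠ ∞ := by
  obtain ⟨B, hB⟩ := hD.exists_bound one_pos hγ hf
  refine ((setLIntegral_mono' (g := fun _ => ENNReal.ofReal B ^ 2)
    hD.isOpen.measurableSet fun u hu => ?_).trans_lt ?_).ne
  · have : ‖f u‖ₑ ≤ ENNReal.ofReal B := by
      rw [← ofReal_norm]
      exact ENNReal.ofReal_le_ofReal (by simpa using hB u hu 1 (by simp))
    gcongr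
  · rw [setLIntegral_const]
    exact ENNReal.mul_lt_top (by simp) hD.measure_lt_top

/-- Contraction of the `L²` norm under restriction to a smaller dilation, for functions vanishing
to order `K` at the centre; version with a non-sharp factor. -/
theorem IsStrictlyBalanced.lintegral_sq_le_of_lt (hD : IsStrictlyBalanced D) {γ ρ : ℝ}
    (hρ : 1 < ρ) (hργ : ρ < γ) {f : Cn d → ℂ}
    (hf : DifferentiableOn ℂ f ((fun u => (γ : ℂ) • u) '' D)) {K : ℕ}
    (hK : ∀ u : Cn d, (fun ζ : ℂ => f (ζ • u)) =O[𝓝 0] fun ζ : ℂ => ζ ^ K) :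
    ∫⁻ u in D, ‖f u‖ₑ ^ 2 ∂(normVol d) ≤ ENNReal.ofReal ((ρ ^ (2 * (K + d)))⁻¹) *
      ∫⁻ u in (fun u => (γ : ℂ) • u) '' D, ‖f u‖ₑ ^ 2 ∂(normVol d) := by
  have hρ0 : 0 < ρ := one_pos.trans hρ
  have hγ : 1 < γ := hρ.trans hργ
  have hγ0 : 0 < γ := one_pos.trans hγ
  -- Room for the maximum principle: `H` is holomorphic on a disc containing the closed disc of
  -- radius `ρ`.
  obtain ⟨ρ', hρρ', hρ'γ⟩ := exists_between hργ
  have hρ'0 : 0 < ρ' := hρ0.trans hρρ'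
  have hmD : MeasurableSet D := hD.isOpen.measurableSet
  set A := ∫⁻ u in D, ‖f u‖ₑ ^ 2 ∂(normVol d) with hA
  set I := ∫⁻ u in (fun u => (γ : ℂ) • u) '' D, ‖f u‖ₑ ^ 2 ∂(normVol d) with hI
  have hAt : A ≠ ∞ := hD.lintegral_sq_ne_top hγ hf.continuousOn
  rcases eq_or_ne I ∞ with hIt | hIt
  · rw [hIt, ENNReal.mul_top]
    · exact le_top
    · simpa using by positivity
  obtain ⟨B, hB⟩ := hD.exists_bound hρ'0 hρ'γ hf.continuousOn
  set H : ℂ → ℂ := fun ζ => ∫ u in D, f (ζ • u) * (starRingEnd ℂ) (f u) ∂(normVol d) with hH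
  have hHd : DifferentiableOn ℂ H (Metric.ball 0 ρ') :=
    hD.differentiableOn_correlation (hρ.trans hρρ') hρ'γ hf
  have hslice : ∀ u ∈ D, ∀ ζ ∈ Metric.ball (0 : ℂ) ρ', ‖f (ζ • u)‖ ≤ B * (‖ζ‖ / ρ') ^ K := by
    intro u hu ζ hζ
    refine norm_le_mul_div_pow_of_isBigO (h := fun ζ => f (ζ • u)) ?_ ?_ (hK u) hζ
    · exact fun z hz => (hD.hasDerivAt_slice hγ0 hf hu ((mem_ball_zero_iff.1 hz).le.trans
        hρ'γ.le)).differentiableAt.differentiableWithinAt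
    · exact fun z hz => hB u hu z (mem_ball_zero_iff.1 hz).le
  have hHO : H =O[𝓝 0] fun ζ : ℂ => ζ ^ K := by
    refine IsBigO.of_bound (B / ρ' ^ K * B * (normVol d).real D) ?_
    filter_upwards [Metric.ball_mem_nhds (0 : ℂ) hρ'0] with ζ hζ
    have h1 : ∀ u ∈ D, ‖f (ζ • u) * (starRingEnd ℂ) (f u)‖ ≤ B * (‖ζ‖ / ρ') ^ K * B := by
      intro u hu
      have h2 : ‖f u‖ ≤ B := by
        simpa using hB u hu 1 (by simpa using (hρ.trans hρρ').le)
      rw [norm_mul, RCLike.norm_conj]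
      exact mul_le_mul (hslice u hu ζ hζ) h2 (norm_nonneg _)
        ((norm_nonneg _).trans (hslice u hu ζ hζ))
    refine (norm_setIntegral_le_of_norm_le_const hD.measure_lt_top h1).trans_eq ?_
    rw [norm_pow, div_pow]
    ring
  set S : ℝ := √((ρ ^ (2 * d))⁻¹ * I.toReal * A.toReal) with hS
  have hsphere : ∀ ζ : ℂ, ‖ζ‖ = ρ → ‖H ζ‖ ≤ S := by
    intro ζ hζ
    have hζ0 : ζ ≠ 0 := by rintro rfl; simp at hζ; linarith
    have h1 := hD.norm_correlation_le hγ hf (hζ.trans_le hργ.le) hζ0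
    rw [hζ] at h1
    have h2 := ENNReal.toReal_mono
      (ENNReal.mul_ne_top (ENNReal.mul_ne_top ENNReal.ofReal_ne_top hIt) hAt) h1
    rw [ENNReal.toReal_mul, ENNReal.toReal_mul, ENNReal.toReal_pow, toReal_enorm,
      ENNReal.toReal_ofReal (by positivity)] at h2
    exact Real.le_sqrt_of_sq_le h2
  have hball : ∀ ζ ∈ Metric.ball (0 : ℂ) ρ, ‖H ζ‖ ≤ S := by
    intro ζ hζ
    have hdc : DiffContOnCl ℂ H (Metric.ball 0 ρ) := by
      apply DifferentiableOn.diffContOnCl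
      rw [closure_ball _ hρ0.ne']
      exact hHd.mono (Metric.closedBall_subset_ball hρρ')
    refine Complex.norm_le_of_forall_mem_frontier_norm_le Metric.isBounded_ball hdc ?_
      (subset_closure hζ)
    intro z hz
    rw [frontier_ball _ hρ0.ne'] at hz
    exact hsphere z (mem_sphere_zero_iff_norm.1 hz)
  -- The Schwarz lemma evaluated at `ζ = 1`, which lies in the disc because `ρ > 1` and where `H`
  -- equals the integral of `|f|²` over `D`.
  have h1 := norm_le_mul_div_pow_of_isBigO (hHd.mono (Metric.ball_subset_ball hρρ'.le)) hball hHO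
    (z := 1) (by simpa using hρ)
  have hH1 : H 1 = (A.toReal : ℂ) := by
    have h2 : ∀ u, f ((1 : ℂ) • u) * (starRingEnd ℂ) (f u) = ((‖f u‖ ^ 2 : ℝ) : ℂ) := by
      intro u
      rw [one_smul, RCLike.mul_conj]
      norm_cast
    simp only [hH, h2]
    rw [integral_complex_ofReal, integral_eq_lintegral_of_nonneg_ae]
    · congr 3
      funext u
      rw [← ofReal_norm, ENNReal.ofReal_pow (norm_nonneg _)]
    · exact Eventually.of_forall fun u => by positivity
    · have h3 := hD.continuousOn_comp_smul hγ0 hf.continuousOn (ζ := 1) (by simpa using hγ.le)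
      simp only [one_smul] at h3
      exact (h3.norm.pow 2).aestronglyMeasurable hmD
  rw [hH1, Complex.norm_real, Real.norm_of_nonneg ENNReal.toReal_nonneg, norm_one] at h1
  have ha : 0 ≤ A.toReal := ENNReal.toReal_nonneg
  have hi : 0 ≤ I.toReal := ENNReal.toReal_nonneg
  -- `A` also occurs under the root in `S`; squaring and cancelling one factor `A` doubles the
  -- exponent to `2 (K + d)`.
  have h4 : A.toReal ≤ (ρ ^ (2 * (K + d)))⁻¹ * I.toReal := by
    rcases ha.eq_or_lt with h0 | h0
    · rw [← h0]; positivity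
    have h5 : A.toReal ^ 2 ≤ ((ρ ^ (2 * (K + d)))⁻¹ * I.toReal) * A.toReal := by
      calc A.toReal ^ 2 ≤ (S * (1 / ρ) ^ K) ^ 2 := by gcongr
        _ = _ := by
          rw [mul_pow, hS, Real.sq_sqrt (by positivity), one_div, inv_pow, mul_add, pow_add,
            mul_inv, inv_pow, ← pow_mul, mul_comm K 2]
          ring
    rw [sq] at h5
    exact le_of_mul_le_mul_right h5 h0
  rw [← ENNReal.ofReal_toReal hAt, ← ENNReal.ofReal_toReal hIt,
    ← ENNReal.ofReal_mul (by positivity)]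
  exact ENNReal.ofReal_le_ofReal h4

/-- `f` need not be bounded on `γ D`, so the argument runs on smaller circles; the factor is
continuous in the radius, which then tends to `γ`. -/
theorem IsStrictlyBalanced.lintegral_sq_le (hD : IsStrictlyBalanced D) {γ : ℝ}
    (hγ : 1 < γ) {f : Cn d → ℂ}
    (hf : DifferentiableOn ℂ f ((fun u => (γ : ℂ) • u) '' D)) {K : ℕ}
    (hK : ∀ u : Cn d, (fun ζ : ℂ => f (ζ • u)) =O[𝓝 0] fun ζ : ℂ => ζ ^ K) :
    ∫⁻ u in D, ‖f u‖ₑ ^ 2 ∂(normVol d) ≤ ENNReal.ofReal ((γ ^ (2 * (K + d)))⁻¹) *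
      ∫⁻ u in (fun u => (γ : ℂ) • u) '' D, ‖f u‖ₑ ^ 2 ∂(normVol d) := by
  have hγ0 : 0 < γ := one_pos.trans hγ
  have hlim : Tendsto (fun ρ : ℝ => ENNReal.ofReal ((ρ ^ (2 * (K + d)))⁻¹) *
      ∫⁻ u in (fun u => (γ : ℂ) • u) '' D, ‖f u‖ₑ ^ 2 ∂(normVol d)) (𝓝[<] γ)
      (𝓝 (ENNReal.ofReal ((γ ^ (2 * (K + d)))⁻¹) *
      ∫⁻ u in (fun u => (γ : ℂ) • u) '' D, ‖f u‖ₑ ^ 2 ∂(normVol d))) := by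
    refine ENNReal.Tendsto.mul_const ?_ (Or.inl ?_)
    · refine (ENNReal.tendsto_ofReal ?_).mono_left nhdsWithin_le_nhds
      exact ((continuousAt_id.pow _).inv₀ (pow_pos hγ0 _).ne').tendsto
    · simpa using by positivity
  refine ge_of_tendsto hlim ?_
  filter_upwards [Ioo_mem_nhdsLT hγ] with ρ hρ
  exact hD.lintegral_sq_le_of_lt hρ.1 hρ.2 hf hK

theorem StrictlyCircled.isStrictlyBalanced {ζ : Cn d} (hD : StrictlyCircled D ζ)
    (ho : IsOpen D) : IsStrictlyBalanced ((fun z => z - ζ) '' D) where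
  isOpen := (Homeomorph.subRight ζ).isOpenMap _ ho
  isCompact_closure μ hμ := by
    have := (hD μ hμ).1
    rwa [image_image]
  closure_subset μ hμ := by
    have := (hD μ hμ).2
    rwa [image_image]


theorem setLIntegral_translate (ζ : Cn d) {D : Set (Cn d)} (hD : IsOpen D) (g : Cn d → ℝ≥0∞) :
    ∫⁻ u in (fun z => z - ζ) '' D, g (ζ + u) ∂(normVol d) = ∫⁻ u in D, g u ∂(normVol d) := by
  have ho : IsOpen ((fun z => z - ζ) '' D) := (Homeomorph.subRight ζ).isOpenMap _ hD
  rw [← lintegral_indicator hD.measurableSet, ← lintegral_indicator ho.measurableSet,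
    ← lintegral_add_left_eq_self (μ := normVol d) (fun a => D.indicator (fun u => g u) a) ζ]
  refine lintegral_congr fun u => ?_
  have : u ∈ (fun z => z - ζ) '' D ↔ ζ + u ∈ D :=
    ⟨fun ⟨z, hz, h⟩ => by subst h; simpa using hz, fun h => ⟨_, h, by simp⟩⟩
  by_cases hu : ζ + u ∈ D
  · rw [indicator_of_mem (this.2 hu), indicator_of_mem hu]
  · rw [indicator_of_notMem (fun h => hu (this.1 h)), indicator_of_notMem hu]

theorem isOpen_dilate {ζ : Cn d} {r : ℝ} (hr : r ≠ 0) (hD : IsOpen D) :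
    IsOpen (dilate ζ r D) := by
  have hr' : (r : ℂ) ≠ 0 := by exact_mod_cast hr
  exact (((Homeomorph.subRight ζ).trans (Homeomorph.smulOfNeZero (r : ℂ) hr')).trans
    (Homeomorph.addRight ζ)).isOpenMap _ hD

/-- Contraction of the `L²` norm under restriction from `D(γ)` to a strictly circled set `D`, for
functions vanishing to order `K` at the centre. -/
theorem StrictlyCircled.lintegral_sq_le {ζ : Cn d} (hD : StrictlyCircled D ζ) (ho : IsOpen D)
    {γ : ℝ} (hγ : 1 < γ) {f : Cn d → ℂ} (hf : DifferentiableOn ℂ f (dilate ζ γ D)) {K : ℕ}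
    (hK : ∀ u : Cn d, (fun z : ℂ => f (ζ + z • u)) =O[𝓝 0] fun z : ℂ => z ^ K) :
    ∫⁻ u in D, ‖f u‖ₑ ^ 2 ∂(normVol d) ≤ ENNReal.ofReal ((γ ^ (2 * (K + d)))⁻¹) *
      ∫⁻ u in dilate ζ γ D, ‖f u‖ₑ ^ 2 ∂(normVol d) := by
  have himg : (fun u => (γ : ℂ) • u) '' ((fun z => z - ζ) '' D) =
      (fun z => z - ζ) '' dilate ζ γ D := by
    simp [dilate, image_image]
  have h := (hD.isStrictlyBalanced ho).lintegral_sq_le hγ (f := fun u => f (ζ + u)) ?_ hK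
  · rwa [himg, setLIntegral_translate ζ ho (fun u => ‖f u‖ₑ ^ 2), setLIntegral_translate ζ
      (isOpen_dilate (by linarith) ho) (fun u => ‖f u‖ₑ ^ 2)] at h
  · rw [himg]
    refine hf.comp (by fun_prop) ?_
    rintro _ ⟨z, hz, rfl⟩
    simpa using hz

end Dilation

/-! ### Choice of the orders of vanishing. -/

section Counting

theorem efficiencyNorm_pos {d N : ℕ} [Nonempty (Fin N)] {g : Fin N → ℝ} (hg : ∀ j, 0 < g j) :
    0 < efficiencyNorm d g := by
  refine Real.rpow_pos_of_pos (Finset.sum_pos (fun j _ => ?_) Finset.univ_nonempty) _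
  exact Real.rpow_pos_of_pos (abs_pos.2 (hg j).ne') _

/-- This identity is why the decay rate is `‖Γ‖_d`: it makes the ideal real-valued orders use up
codimension exactly `n`. -/
theorem efficiencyNorm_pow_mul_sum {d N : ℕ} (hd : 1 ≤ d) [Nonempty (Fin N)] {g : Fin N → ℝ}
    (hg : ∀ j, 0 < g j) : efficiencyNorm d g ^ d * ∑ j, (g j ^ d)⁻¹ = 1 := by
  have hs : ∑ j, |g j| ^ (-(d : ℝ)) = ∑ j, (g j ^ d)⁻¹ := Finset.sum_congr rfl fun j _ => by
    rw [abs_of_pos (hg j), Real.rpow_neg (hg j).le, Real.rpow_natCast]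
  have hpos : 0 < ∑ j, (g j ^ d)⁻¹ :=
    Finset.sum_pos (fun j _ => inv_pos.2 (pow_pos (hg j) d)) Finset.univ_nonempty
  have hd' : (d : ℝ) ≠ 0 := by exact_mod_cast (by omega : d ≠ 0)
  rw [efficiencyNorm, hs, ← Real.rpow_natCast, ← Real.rpow_mul hpos.le, neg_mul,
    one_div_mul_cancel hd', Real.rpow_neg_one, inv_mul_cancel₀ hpos.ne']

/-- The choice of the orders of vanishing at the centres of a relative cover. -/
theorem exists_orders {d N : ℕ} (hd : 1 ≤ d) [Nonempty (Fin N)] {g : Fin N → ℝ}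
    (hg : ∀ j, 0 < g j) {n : ℕ} (hn : 1 ≤ n) : ∃ K : Fin N → ℕ, ∑ j, K j ^ d < n ∧
      ∀ j, efficiencyNorm d g * (n : ℝ) ^ (1 / (d : ℝ)) + ((d : ℝ) - 1) / 2 * g j ≤
        g j * (K j + d : ℕ) := by
  set c := efficiencyNorm d g with hc
  have hc0 : 0 < c := efficiencyNorm_pos hg
  have hn0 : (0 : ℝ) < n := by exact_mod_cast hn
  have hd1 : (1 : ℝ) ≤ d := by exact_mod_cast hd
  set y : ℝ := c * (n : ℝ) ^ (1 / (d : ℝ)) with hy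
  have hy0 : 0 < y := mul_pos hc0 (Real.rpow_pos_of_pos hn0 _)
  have hx0 : ∀ j, 0 < y / g j := fun j => div_pos hy0 (hg j)
  have hyd : y ^ d = c ^ d * n := by
    rw [hy, mul_pow, ← Real.rpow_natCast ((n : ℝ) ^ _), ← Real.rpow_mul hn0.le,
      one_div_mul_cancel (by positivity), Real.rpow_one]
  have hsum : ∑ j, (y / g j) ^ d = n := by
    simp_rw [div_pow, div_eq_mul_inv]
    rw [← Finset.mul_sum, hyd, mul_right_comm, efficiencyNorm_pow_mul_sum hd hg, one_mul]
  -- The shift `(d + 1) / 2` is at least `1`, so the ceiling stays strictly below `y / g j`, which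
  -- is positive even when the ceiling is `0`. Adding `d` back leaves the surplus `(d - 1) / 2`.
  refine ⟨fun j => ⌈y / g j - ((d : ℝ) + 1) / 2⌉₊, ?_, fun j => ?_⟩
  · have hlt : ∀ j, (⌈y / g j - ((d : ℝ) + 1) / 2⌉₊ : ℝ) < y / g j := by
      intro j
      rcases le_or_gt (y / g j - ((d : ℝ) + 1) / 2) 0 with h | h
      · rw [Nat.ceil_eq_zero.2 h]
        simpa using hx0 j
      · have := Nat.ceil_lt_add_one h.le
        linarith
    have : (∑ j, (⌈y / g j - ((d : ℝ) + 1) / 2⌉₊ : ℝ) ^ d) < n := by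
      rw [← hsum]
      exact Finset.sum_lt_sum_of_nonempty Finset.univ_nonempty fun j _ =>
        pow_lt_pow_left₀ (hlt j) (by positivity) (by omega)
    exact_mod_cast this
  · have h1 := Nat.le_ceil (y / g j - ((d : ℝ) + 1) / 2)
    have h2 : y = g j * (y / g j) := by field_simp [(hg j).ne']
    push_cast
    have h3 := mul_le_mul_of_nonneg_left h1 (hg j).le
    have h4 := hg j
    nlinarith

end Counting

/-! ### Restriction along a relative cover. -/

section Cover

open Asymptotics

variable {d : ℕ}

theorem eLpNorm_two_sq {α E : Type*} [MeasurableSpace α] {μ : Measure α} [TopologicalSpace E]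
    [ContinuousENorm E] (f : α → E) : eLpNorm f 2 μ ^ 2 = ∫⁻ x, ‖f x‖ₑ ^ 2 ∂μ := by
  have := eLpNorm_nnreal_pow_eq_lintegral (f := f) (μ := μ) (p := 2) two_ne_zero
  simpa only [ENNReal.coe_ofNat, NNReal.coe_ofNat, ENNReal.rpow_two] using this

theorem Bergman.enorm_eq {Ω : TopologicalSpace.Opens (Cn d)} (F : Bergman Ω) :
    ‖F‖ₑ = eLpNorm F.toFun 2 ((normVol d).restrict (Ω : Set (Cn d))) := by
  rw [← ofReal_norm, ← F.toReal_eLpNorm, ENNReal.ofReal_toReal F.eLpNorm_ne_top]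

/-- On the kernel of a linear map of rank at most `∑ j, K_j ^ d`, restriction to the second set of
a relative cover is a strong contraction. -/
theorem RelativeCover.exists_linearMap_ker_le {Ω₁ Ω₂ : TopologicalSpace.Opens (Cn d)} {N : ℕ}
    (C : RelativeCover (Ω₁ : Set (Cn d)) (Ω₂ : Set (Cn d)) N) (K : Fin N → ℕ) {q : ℝ}
    (hq : ∀ j, (C.scaling j ^ (K j + d))⁻¹ ≤ q) :
    ∃ Φ : Bergman Ω₁ →ₗ[ℂ] (∀ j, boxSpan d (K j)), ∀ f : Bergman Ω₁, Φ f = 0 →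
      eLpNorm f.toFun 2 ((normVol d).restrict (Ω₂ : Set (Cn d))) ≤
        ENNReal.ofReal (N * q) * ‖f‖ₑ := by
  have hdil : ∀ j, dilate (C.centre j) (C.scaling j) (C.dom j) ⊆ (Ω₁ : Set (Cn d)) := fun j =>
    (subset_iUnion (fun j => dilate (C.centre j) (C.scaling j) (C.dom j)) j).trans C.dilate_subset
  -- The case `μ = 0` of circledness puts the centre into any nonempty `D_j`. For empty `D_j` the
  -- centre may lie anywhere, and the zero map serves.
  have hcentre : ∀ j, (C.dom j).Nonempty → C.centre j ∈ Ω₁ := by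
    rintro j ⟨z, hz⟩
    have h1 := (C.strictlyCircled j 0 (by simp)).2 (subset_closure ⟨z, hz, rfl⟩)
    obtain ⟨z', hz', h2⟩ := h1
    refine hdil j ⟨z', hz', ?_⟩
    have : z' - C.centre j = 0 := by simpa using h2
    simp [this]
  have hex : ∀ j, ∃ Φ : Bergman Ω₁ →ₗ[ℂ] boxSpan d (K j), ∀ f : Bergman Ω₁, Φ f = 0 →
      ∫⁻ u in C.dom j, ‖f u‖ₑ ^ 2 ∂(normVol d) ≤ ENNReal.ofReal q ^ 2 * ‖f‖ₑ ^ 2 := by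
    intro j
    rcases (C.dom j).eq_empty_or_nonempty with he | hne
    · exact ⟨0, fun f _ => by simp [he]⟩
    obtain ⟨Φ, hΦ⟩ := exists_linearMap_ker_vanishing Ω₁ (hcentre j hne) (K j)
    refine ⟨Φ, fun f hf => ?_⟩
    have hγ := C.one_lt_scaling j
    have h1 := (C.strictlyCircled j).lintegral_sq_le (C.isOpen_dom j) hγ
      (f.differentiableOn.mono (hdil j)) (hΦ f hf)
    refine h1.trans (mul_le_mul' ?_ ?_)
    · rw [← ENNReal.ofReal_pow ((inv_nonneg.2 (by positivity)).trans (hq j))]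
      refine ENNReal.ofReal_le_ofReal ?_
      rw [mul_comm 2, pow_mul, ← inv_pow]
      gcongr
      exact hq j
    · rw [f.enorm_eq, eLpNorm_two_sq]
      exact lintegral_mono_set (hdil j)
  choose Φ hΦ using hex
  refine ⟨LinearMap.pi Φ, fun f hf => ?_⟩
  have hfj : ∀ j, Φ j f = 0 := fun j => congrFun hf j
  rw [← ENNReal.pow_le_pow_left_iff two_ne_zero, eLpNorm_two_sq]
  rcases Nat.eq_zero_or_pos N with hN | hN
  · subst hN
    have : (Ω₂ : Set (Cn d)) = ∅ := by
      have := C.covers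
      simpa using this
    simp [this]
  have hq0 : 0 ≤ q := (inv_nonneg.2 (pow_nonneg
    (zero_le_one.trans (C.one_lt_scaling ⟨0, hN⟩).le) _)).trans (hq ⟨0, hN⟩)
  calc ∫⁻ u in (Ω₂ : Set (Cn d)), ‖f u‖ₑ ^ 2 ∂(normVol d)
      ≤ ∫⁻ u in ⋃ j, C.dom j, ‖f u‖ₑ ^ 2 ∂(normVol d) := lintegral_mono_set C.covers
    _ ≤ ∑' j, ∫⁻ u in C.dom j, ‖f u‖ₑ ^ 2 ∂(normVol d) := lintegral_iUnion_le _ _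
    _ ≤ ∑' _ : Fin N, ENNReal.ofReal q ^ 2 * ‖f‖ₑ ^ 2 :=
        ENNReal.tsum_le_tsum fun j => hΦ j f (hfj j)
    _ = N * (ENNReal.ofReal q ^ 2 * ‖f‖ₑ ^ 2) := by simp [tsum_fintype]
    -- Summing squares gives the factor `√N` on norms; it is relaxed to the `N` of the stated bound.
    _ ≤ (N : ℝ≥0∞) ^ 2 * (ENNReal.ofReal q ^ 2 * ‖f‖ₑ ^ 2) := by
        gcongr
        exact_mod_cast Nat.le_self_pow two_ne_zero N
    _ = _ := by
        rw [ENNReal.ofReal_mul (by positivity), ENNReal.ofReal_natCast]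
        ring

theorem finrank_pi_boxSpan_le {N : ℕ} (K : Fin N → ℕ) :
    Module.finrank ℂ (∀ j, boxSpan d (K j)) ≤ ∑ j, K j ^ d := by
  rw [Module.finrank_pi_fintype]
  exact Finset.sum_le_sum fun j _ => finrank_boxSpan_le d (K j)

/-- For each `n` the restriction map of a relative cover is exponentially small on a subspace of
codimension less than `n`. -/
theorem RelativeCover.exists_linearMap_ker_le_exp (hd : 1 ≤ d)
    {Ω₁ Ω₂ : TopologicalSpace.Opens (Cn d)} {N : ℕ} [Nonempty (Fin N)]
    (C : RelativeCover (Ω₁ : Set (Cn d)) (Ω₂ : Set (Cn d)) N) {n : ℕ} (hn : 1 ≤ n) :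
    ∃ K : Fin N → ℕ, ∃ Φ : Bergman Ω₁ →ₗ[ℂ] (∀ j, boxSpan d (K j)),
      Module.finrank ℂ (∀ j, boxSpan d (K j)) < n ∧ ∀ f : Bergman Ω₁, Φ f = 0 →
      eLpNorm f.toFun 2 ((normVol d).restrict (Ω₂ : Set (Cn d))) ≤
        ENNReal.ofReal (N * Real.exp (-(((d : ℝ) - 1) / 2) * ⨅ j, C.efficiency j) *
          Real.exp (-efficiencyNorm d C.efficiency * (n : ℝ) ^ (1 / (d : ℝ)))) * ‖f‖ₑ := by
  have hg : ∀ j, 0 < C.efficiency j := fun j => Real.log_pos (C.one_lt_scaling j)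
  obtain ⟨K, hK, hKj⟩ := exists_orders hd hg hn
  have hd1 : (1 : ℝ) ≤ d := by exact_mod_cast hd
  have hq : ∀ j, (C.scaling j ^ (K j + d))⁻¹ ≤
      Real.exp (-(((d : ℝ) - 1) / 2) * ⨅ j, C.efficiency j) *
        Real.exp (-efficiencyNorm d C.efficiency * (n : ℝ) ^ (1 / (d : ℝ))) := by
    intro j
    have hγ : 0 < C.scaling j := one_pos.trans (C.one_lt_scaling j)
    have h1 : (C.scaling j ^ (K j + d))⁻¹ = Real.exp (-(C.efficiency j * (K j + d : ℕ))) := by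
      rw [Real.exp_neg, mul_comm, Real.exp_nat_mul, RelativeCover.efficiency, Real.exp_log hγ]
    rw [h1, ← Real.exp_add, Real.exp_le_exp]
    have h2 : ⨅ j, C.efficiency j ≤ C.efficiency j := ciInf_le (Set.finite_range _).bddBelow j
    have h3 := mul_le_mul_of_nonneg_left h2 (by linarith : (0 : ℝ) ≤ ((d : ℝ) - 1) / 2)
    linarith [hKj j]
  obtain ⟨Φ, hΦ⟩ := C.exists_linearMap_ker_le K hq
  refine ⟨K, Φ, (finrank_pi_boxSpan_le K).trans_lt hK, fun f hf => ?_⟩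
  rw [mul_assoc]
  exact hΦ f hf

end Cover

/-! ### Point evaluations and distances to the boundary. -/

section PointEvaluation

variable {d : ℕ}

theorem normVol_ball (hd : 1 ≤ d) {r : ℝ} (hr : 0 ≤ r) :
    normVol d (Metric.ball 0 r) = ENNReal.ofReal r ^ (2 * d) := by
  have : Nonempty (Fin d) := ⟨⟨0, hd⟩⟩
  have h1 : normVol d (Metric.ball 0 1) = 1 := by
    rw [normVol, Measure.smul_apply, smul_eq_mul]
    exact ENNReal.inv_mul_cancel (Metric.measure_ball_pos _ _ one_pos).ne' measure_ball_lt_top.ne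
  rw [Measure.addHaar_ball _ _ hr, h1, mul_one, finrank_real_Cn, ENNReal.ofReal_pow hr]

/-- Sharp bound for the point evaluations of holomorphic `L²` functions. -/
theorem enorm_le_of_ball_subset (hd : 1 ≤ d) {Ω : Set (Cn d)} {z : Cn d} {r : ℝ}
    (hr : 0 < r) (hz : Metric.ball z r ⊆ Ω) {f : Cn d → ℂ} (hf : DifferentiableOn ℂ f Ω) :
    ‖f z‖ₑ ≤ ENNReal.ofReal (r⁻¹ ^ d) * eLpNorm f 2 ((normVol d).restrict Ω) := by
  set m : ℝ≥0∞ := ENNReal.ofReal r with hm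
  have hm0 : m ≠ 0 := by simpa [hm] using hr
  have hmt : m ≠ ∞ := ENNReal.ofReal_ne_top
  have hmeas : AEStronglyMeasurable f ((normVol d).restrict (Metric.ball z r)) :=
    ((hf.mono hz).continuousOn).aestronglyMeasurable measurableSet_ball
  have h1 := subMean (hf.mono hz)
  have h2 := eLpNorm_le_eLpNorm_mul_rpow_measure_univ (p := 1) (q := 2) (by norm_num) hmeas
  have h3 : eLpNorm f 2 ((normVol d).restrict (Metric.ball z r)) ≤
      eLpNorm f 2 ((normVol d).restrict Ω) :=
    eLpNorm_mono_measure _ (Measure.restrict_mono hz le_rfl)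
  have hball : normVol d (Metric.ball z r) = m ^ (2 * d) := by
    rw [Measure.addHaar_ball_center, normVol_ball hd hr.le]
  rw [eLpNorm_one_eq_lintegral_enorm, Measure.restrict_apply_univ, hball] at h2
  -- Hölder contributes the square root `r^d` of the ball's mass `r^{2d}`; dividing the mean value
  -- inequality by the full mass leaves `r^{-d}`.
  have hpow : (m ^ (2 * d)) ^ (1 / (1 : ℝ≥0∞).toReal - 1 / (2 : ℝ≥0∞).toReal) = m ^ d := by
    rw [← ENNReal.rpow_natCast, ← ENNReal.rpow_natCast, ← ENNReal.rpow_mul]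
    congr 1
    push_cast
    norm_num
    ring
  rw [hpow] at h2
  rw [normVol_ball hd hr.le] at h1
  have h4 : m ^ (2 * d) * ‖f z‖ₑ ≤ m ^ d * eLpNorm f 2 ((normVol d).restrict Ω) := by
    refine (h1.trans h2).trans ?_
    rw [mul_comm]
    gcongr
  rw [two_mul, pow_add, mul_assoc,
    ENNReal.mul_le_mul_iff_right (pow_ne_zero _ hm0) (ENNReal.pow_ne_top hmt)] at h4
  have h5 : ENNReal.ofReal (r⁻¹ ^ d) = (m ^ d)⁻¹ := by
    rw [inv_pow, ENNReal.ofReal_inv_of_pos (by positivity), ENNReal.ofReal_pow hr.le]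
  rw [h5]
  calc ‖f z‖ₑ = (m ^ d)⁻¹ * (m ^ d * ‖f z‖ₑ) := by
        rw [← mul_assoc, ENNReal.inv_mul_cancel (pow_ne_zero _ hm0) (ENNReal.pow_ne_top hmt),
          one_mul]
    _ ≤ _ := by gcongr

theorem setDist_le_dist {A B : Set (Cn d)} {a b : Cn d} (ha : a ∈ A) (hb : b ∈ B) :
    setDist A B ≤ dist a b := by
  refine csInf_le ⟨0, ?_⟩ (mem_image2_of_mem ha hb)
  rintro _ ⟨x, -, y, -, rfl⟩
  exact dist_nonneg

/-- A ball is connected, meets `Ω` at its centre and misses the frontier, so it cannot leave `Ω`. -/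
theorem ball_setDist_subset {A Ω : Set (Cn d)} (hΩ : IsOpen Ω) (hA : A ⊆ Ω) {a : Cn d}
    (ha : a ∈ A) : Metric.ball a (setDist A (frontier Ω)) ⊆ Ω := by
  rcases le_or_gt (setDist A (frontier Ω)) 0 with h | h
  · rw [Metric.ball_eq_empty.2 h]
    exact empty_subset _
  refine Metric.isPreconnected_ball.subset_of_closure_inter_subset hΩ
    ⟨a, Metric.mem_ball_self h, hA ha⟩ ?_
  rintro x ⟨hx, hxb⟩
  by_contra hxΩ
  have hxf : x ∈ frontier Ω := by rw [hΩ.frontier_eq]; exact ⟨hx, hxΩ⟩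
  have := setDist_le_dist ha hxf
  rw [Metric.mem_ball, dist_comm] at hxb
  linarith

/-- A set with empty frontier is empty or everything, and the whole space is not compact.
Nonemptiness matters because `setDist` to an empty set takes the default value `0`. -/
theorem frontier_nonempty_of_compactlyContained (hd : 1 ≤ d) {Ω : Set (Cn d)} (hne : Ω.Nonempty)
    (hc : IsCompact (closure Ω)) : (frontier Ω).Nonempty := by
  have : Nonempty (Fin d) := ⟨⟨0, hd⟩⟩
  have : NoncompactSpace (Cn d) := NormedSpace.noncompactSpace ℂ (Cn d)
  refine nonempty_frontier_iff.2 ⟨hne, ?_⟩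
  rintro rfl
  rw [closure_univ] at hc
  exact noncompact_univ _ hc

/-- The distances from compactly contained sets to the boundary are bounded from below. -/
theorem exists_pos_le_setDist {I : Type*} {A : I → Set (Cn d)} {Ω : Set (Cn d)} (hΩ : IsOpen Ω)
    (hA : CompactlyContained (⋃ i, A i) Ω) (hf : (frontier Ω).Nonempty) :
    ∃ δ > 0, ∀ i, (A i).Nonempty → δ ≤ setDist (A i) (frontier Ω) := by
  obtain ⟨δ, hδ, h⟩ := hA.1.exists_thickening_subset_open hΩ hA.2
  refine ⟨δ, hδ, fun i hi => le_csInf (hi.image2 hf) ?_⟩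
  rintro _ ⟨a, ha, b, hb, rfl⟩
  by_contra! hlt
  rw [hΩ.frontier_eq] at hb
  refine hb.2 (h (Metric.mem_thickening_iff.2 ⟨a, subset_closure (mem_iUnion.2 ⟨i, ha⟩), ?_⟩))
  rwa [dist_comm]

end PointEvaluation

/-! ### Series in the Bergman space with an `L²` majorant. -/

section WeightedSeries

variable {d : ℕ} {Ω : TopologicalSpace.Opens (Cn d)} {I : Type*}

theorem Bergman.enorm_sq (F : Bergman Ω) :
    ‖F‖ₑ ^ 2 = ∫⁻ z in (Ω : Set (Cn d)), ‖F z‖ₑ ^ 2 ∂(normVol d) := by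
  rw [F.enorm_eq, eLpNorm_two_sq]

theorem Bergman.exists_eqOn {g : Cn d → ℂ} (hg : DifferentiableOn ℂ g Ω)
    (hfin : eLpNorm g 2 ((normVol d).restrict (Ω : Set (Cn d))) < ∞) :
    ∃ G : Bergman Ω, EqOn G.toFun g Ω := by
  have hm : MemLp g 2 ((normVol d).restrict (Ω : Set (Cn d))) :=
    ⟨hg.continuousOn.aestronglyMeasurable Ω.isOpen.measurableSet, hfin⟩
  let G : Bergman Ω := ⟨hm.toLp g, g, hg, hm.coeFn_toLp⟩
  exact ⟨G, G.eqOn_toFun hg hm.coeFn_toLp⟩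

theorem Bergman.eqOn_sum (g : I → Bergman Ω) (s : Finset I) :
    EqOn (∑ i ∈ s, g i).toFun (fun z => ∑ i ∈ s, g i z) Ω := by
  classical
  induction s using Finset.induction_on with
  | empty =>
    intro z hz
    have := Bergman.eqOn_smul 0 (0 : Bergman Ω) hz
    rw [zero_smul] at this
    simpa using this
  | insert i s hi ih =>
    intro z hz
    rw [Finset.sum_insert hi, Bergman.eqOn_add _ _ hz, Pi.add_apply, ih hz]
    simp only
    rw [Finset.sum_insert hi]

theorem Bergman.enorm_sum_sq_le (g : I → Bergman Ω) (v : I → Cn d → ℝ≥0∞) (E : ℝ≥0∞)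
    (hE : E ≠ ∞) (hgv : ∀ i, ∀ z ∈ Ω, ‖g i z‖ₑ ≤ v i z * E) (s : Finset I) :
    ‖∑ i ∈ s, g i‖ₑ ^ 2 ≤
      (∫⁻ z in (Ω : Set (Cn d)), (∑ i ∈ s, v i z) ^ 2 ∂(normVol d)) * E ^ 2 := by
  rw [Bergman.enorm_sq, ← lintegral_mul_const' _ _ (ENNReal.pow_ne_top hE)]
  refine setLIntegral_mono' Ω.isOpen.measurableSet fun z hz => ?_
  rw [Bergman.eqOn_sum g s hz, ← mul_pow, Finset.sum_mul]
  gcongr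
  exact (enorm_sum_le _ _).trans (Finset.sum_le_sum fun i _ => hgv i z hz)

/-- Comparison test for series in the Bergman space with a majorant in `L²`. -/
theorem Bergman.summable_of_enorm_le [Countable I] (g : I → Bergman Ω) (v : I → Cn d → ℝ≥0∞)
    (E : ℝ≥0∞) (hE : E ≠ ∞) (hgv : ∀ i, ∀ z ∈ Ω, ‖g i z‖ₑ ≤ v i z * E)
    (hvm : ∀ i, AEMeasurable (v i) ((normVol d).restrict (Ω : Set (Cn d))))
    (hv : ∫⁻ z in (Ω : Set (Cn d)), (∑' i, v i z) ^ 2 ∂(normVol d) ≠ ∞) : Summable g := by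
  classical
  -- Dominated convergence along finite subsets: the tails vanish wherever the full majorant is
  -- finite, hence almost everywhere, and its square dominates. This is the Cauchy criterion in
  -- disguise.
  have hlim : Tendsto (fun s : Finset I => (∫⁻ z in (Ω : Set (Cn d)),
      (∑' i : {x // x ∉ s}, v i z) ^ 2 ∂(normVol d)) * E ^ 2) atTop (𝓝 0) := by
    rw [← zero_mul (E ^ 2)]
    refine ENNReal.Tendsto.mul_const ?_ (Or.inr (ENNReal.pow_ne_top hE))
    have h := tendsto_lintegral_filter_of_dominated_convergence'
      (μ := (normVol d).restrict (Ω : Set (Cn d))) (l := (atTop : Filter (Finset I)))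
      (F := fun s z => (∑' i : {x // x ∉ s}, v i z) ^ 2) (f := fun _ => 0)
      (fun z => (∑' i, v i z) ^ 2) ?_ ?_ hv ?_
    · simpa using h
    · exact Eventually.of_forall fun s =>
        (AEMeasurable.tsum fun i : {x // x ∉ s} => hvm i).pow_const 2
    · refine Eventually.of_forall fun s => Eventually.of_forall fun z => ?_
      gcongr
      exact ENNReal.tsum_comp_le_tsum_of_injective Subtype.val_injective (fun i => v i z)
    · have hfin := ae_lt_top' ((AEMeasurable.tsum hvm).pow_const 2) hv
      filter_upwards [hfin] with z hz
      have h1 : ∑' i, v i z ≠ ∞ := fun h => by simp [h] at hz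
      have := (ENNReal.tendsto_tsum_compl_atTop_zero h1)
      simpa using ENNReal.Tendsto.pow (n := 2) this
  rw [summable_iff_vanishing_norm]
  intro ε hε
  have hε' : (0 : ℝ≥0∞) < ENNReal.ofReal ε ^ 2 := by
    have : 0 < ENNReal.ofReal ε := ENNReal.ofReal_pos.2 hε
    positivity
  obtain ⟨s, hs⟩ := (hlim.eventually (gt_mem_nhds hε')).exists
  refine ⟨s, fun t ht => ?_⟩
  have h1 : ‖∑ i ∈ t, g i‖ₑ ^ 2 < ENNReal.ofReal ε ^ 2 := by
    refine (Bergman.enorm_sum_sq_le g v E hE hgv t).trans_lt (lt_of_le_of_lt ?_ hs)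
    gcongr with z
    have h2 : ∑ i ∈ t, v i z = ∑ i ∈ t.subtype (fun i => i ∉ s), v i z := by
      rw [Finset.sum_subtype_of_mem (fun i => v i z)]
      exact fun i hi hs => Finset.disjoint_left.1 ht hi hs
    rw [h2]
    exact ENNReal.sum_le_tsum (f := fun i : {x // x ∉ s} => v i z) _
  have h2 := (ENNReal.pow_lt_pow_left_iff two_ne_zero).1 h1
  rw [← ofReal_norm, ENNReal.ofReal_lt_ofReal_iff hε] at h2
  exact h2

theorem Bergman.enorm_hasSum_le (g : I → Bergman Ω) (v : I → Cn d → ℝ≥0∞)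
    (E : ℝ≥0∞) (hE : E ≠ ∞) (hgv : ∀ i, ∀ z ∈ Ω, ‖g i z‖ₑ ≤ v i z * E) {G : Bergman Ω}
    (hG : HasSum g G) :
    ‖G‖ₑ ≤ eLpNorm (fun z => ∑' i, v i z) 2 ((normVol d).restrict (Ω : Set (Cn d))) * E := by
  refine le_of_tendsto (hG.enorm) (Eventually.of_forall fun s => ?_)
  rw [← ENNReal.pow_le_pow_left_iff two_ne_zero, mul_pow, eLpNorm_two_sq]
  refine (Bergman.enorm_sum_sq_le g v E hE hgv s).trans ?_
  gcongr with z
  exact ENNReal.sum_le_tsum s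

end WeightedSeries

/-! ### Existence, uniqueness and the norm bound for the transfer operator. -/

section TransferOperator

variable {d : ℕ} {Ω Ω' : TopologicalSpace.Opens (Cn d)} {I : Type*}

theorem eLpNorm_two_lt_top_iff {α E : Type*} [MeasurableSpace α] {μ : Measure α}
    [TopologicalSpace E] [ContinuousENorm E] (f : α → E) :
    eLpNorm f 2 μ < ∞ ↔ ∫⁻ x, ‖f x‖ₑ ^ 2 ∂μ < ∞ := by
  rw [← eLpNorm_two_sq, ENNReal.pow_lt_top_iff]
  simp

theorem HolomorphicMapWeightSystem.mapsTo (S : HolomorphicMapWeightSystem Ω Ω' I)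
    {U : Set (Cn d)} (h : CompactlyContained (⋃ i, S.φ i '' Ω) U) (i : I) {z : Cn d}
    (hz : z ∈ Ω) : S.φ i z ∈ U :=
  h.2 (subset_closure (mem_iUnion.2 ⟨i, mem_image_of_mem _ hz⟩))

/-- The weighted modulus `|w_i| r_i^{-d}`, with `r_i` the distance of `φ_i(Ω)` to the boundary
of `U`. -/
noncomputable def HolomorphicMapWeightSystem.majorant (S : HolomorphicMapWeightSystem Ω Ω' I)
    (U : Set (Cn d)) (i : I) (z : Cn d) : ℝ≥0∞ :=
  ‖S.w i z‖ₑ * ENNReal.ofReal ((setDist (S.φ i '' Ω) (frontier U))⁻¹ ^ d)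

theorem HolomorphicMapWeightSystem.aemeasurable_majorant
    (S : HolomorphicMapWeightSystem Ω Ω' I) (U : Set (Cn d)) (i : I) :
    AEMeasurable (S.majorant U i) ((normVol d).restrict (Ω : Set (Cn d))) :=
  (((S.w i).differentiableOn.continuousOn.aestronglyMeasurable
    Ω.isOpen.measurableSet).enorm).mul_const _

/-- A uniform lower bound on the `r_i` reduces the claim to square-integrability of `∑ |w_i|`. -/
theorem HolomorphicMapWeightSystem.eLpNorm_majorant_lt_top
    (S : HolomorphicMapWeightSystem Ω Ω' I) {U : Set (Cn d)} {δ : ℝ} (hδ : 0 < δ)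
    (h : ∀ i, δ ≤ setDist (S.φ i '' Ω) (frontier U)) :
    eLpNorm (fun z => ∑' i, S.majorant U i z) 2
      ((normVol d).restrict (Ω : Set (Cn d))) < ∞ := by
  have h1 : ∀ z, ∑' i, S.majorant U i z ≤ (∑' i, ‖S.w i z‖ₑ) * ENNReal.ofReal (δ⁻¹ ^ d) := by
    intro z
    rw [← ENNReal.tsum_mul_right]
    refine ENNReal.tsum_le_tsum fun i => ?_
    rw [HolomorphicMapWeightSystem.majorant]
    have := hδ.trans_le (h i)
    gcongr
    exact h i
  rw [eLpNorm_two_lt_top_iff]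
  calc ∫⁻ z in (Ω : Set (Cn d)), ‖∑' i, S.majorant U i z‖ₑ ^ 2 ∂(normVol d)
      ≤ ∫⁻ z in (Ω : Set (Cn d)), ‖∑' i, ‖S.w i z‖ₑ‖ₑ ^ 2 *
          ENNReal.ofReal (δ⁻¹ ^ d) ^ 2 ∂(normVol d) := by
        refine lintegral_mono fun z => ?_
        rw [← mul_pow]
        exact pow_le_pow_left' (h1 z) 2
    _ = eLpNorm (fun z => ∑' i, ‖S.w i z‖ₑ) 2 ((normVol d).restrict (Ω : Set (Cn d))) ^ 2 *
          ENNReal.ofReal (δ⁻¹ ^ d) ^ 2 := by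
        rw [lintegral_mul_const' _ _ (by simp), eLpNorm_two_sq]
    _ < ∞ := ENNReal.mul_lt_top (ENNReal.pow_lt_top S.memLp.2) (by simp)

theorem HolomorphicMapWeightSystem.enorm_term_le (hd : 1 ≤ d)
    (S : HolomorphicMapWeightSystem Ω Ω' I) {U : TopologicalSpace.Opens (Cn d)}
    (hU : CompactlyContained (⋃ i, S.φ i '' Ω) U) (hUΩ : (U : Set (Cn d)) ⊆ Ω')
    (hpos : ∀ i, 0 < setDist (S.φ i '' Ω) (frontier (U : Set (Cn d)))) (f : Bergman Ω') (i : I)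
    {z : Cn d} (hz : z ∈ Ω) : ‖S.w i z * f (S.φ i z)‖ₑ ≤
      S.majorant U i z * eLpNorm f.toFun 2 ((normVol d).restrict (U : Set (Cn d))) := by
  rw [enorm_mul, HolomorphicMapWeightSystem.majorant, mul_assoc]
  gcongr
  refine enorm_le_of_ball_subset hd (hpos i) ?_ (f.differentiableOn.mono hUΩ)
  refine ball_setDist_subset U.isOpen ?_ (mem_image_of_mem _ hz)
  rintro _ ⟨y, hy, rfl⟩
  exact S.mapsTo hU i hy

theorem Bergman.eLpNorm_le_enorm {U : Set (Cn d)} (hUΩ : U ⊆ Ω') (f : Bergman Ω') :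
    eLpNorm f.toFun 2 ((normVol d).restrict U) ≤ ‖f‖ₑ := by
  rw [f.enorm_eq]
  exact eLpNorm_mono_measure _ (Measure.restrict_mono hUΩ le_rfl)

/-- The factorisation through restriction: only the norm of `f` on `U` appears on the right, so
smallness of `f` there passes to `L f`. -/
theorem HolomorphicMapWeightSystem.IsTransferOperator.enorm_le (hd : 1 ≤ d)
    {S : HolomorphicMapWeightSystem Ω Ω' I} {U : TopologicalSpace.Opens (Cn d)}
    (hU : CompactlyContained (⋃ i, S.φ i '' Ω) U) (hUΩ : (U : Set (Cn d)) ⊆ Ω')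
    (hpos : ∀ i, 0 < setDist (S.φ i '' Ω) (frontier (U : Set (Cn d))))
    {L : Bergman Ω' →L[ℂ] Bergman Ω} (hL : S.IsTransferOperator L) (f : Bergman Ω') :
    ‖L f‖ₑ ≤ eLpNorm (fun z => ∑' i, S.majorant U i z) 2
        ((normVol d).restrict (Ω : Set (Cn d))) *
      eLpNorm f.toFun 2 ((normVol d).restrict (U : Set (Cn d))) := by
  obtain ⟨g, hg, hsum⟩ := hL f
  refine Bergman.enorm_hasSum_le g (S.majorant U) _
    ((Bergman.eLpNorm_le_enorm hUΩ f).trans_lt enorm_lt_top).ne (fun i z hz => ?_) hsum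
  rw [hg i hz]
  exact S.enorm_term_le hd hU hUΩ hpos f i hz

theorem HolomorphicMapWeightSystem.IsTransferOperator.unique
    {S : HolomorphicMapWeightSystem Ω Ω' I} {L L' : Bergman Ω' →L[ℂ] Bergman Ω}
    (hL : S.IsTransferOperator L) (hL' : S.IsTransferOperator L') : L = L' := by
  ext1 f
  obtain ⟨g, hg, hs⟩ := hL f
  obtain ⟨g', hg', hs'⟩ := hL' f
  have : g = g' := funext fun i => Bergman.ext_on ((hg i).trans (hg' i).symm)
  exact hs.unique (this ▸ hs')

/-- Each term is determined by its values on `Ω`, so linearity in `f` is checked pointwise and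
passes to the sum; the majorant gives summability and continuity. -/
theorem HolomorphicMapWeightSystem.exists_isTransferOperator [Countable I] (hd : 1 ≤ d)
    (S : HolomorphicMapWeightSystem Ω Ω' I) {U : TopologicalSpace.Opens (Cn d)}
    (hU : CompactlyContained (⋃ i, S.φ i '' Ω) U) (hUΩ : (U : Set (Cn d)) ⊆ Ω')
    (hpos : ∀ i, 0 < setDist (S.φ i '' Ω) (frontier (U : Set (Cn d))))
    (hfin : eLpNorm (fun z => ∑' i, S.majorant U i z) 2
      ((normVol d).restrict (Ω : Set (Cn d))) < ∞) :
    ∃ L : Bergman Ω' →L[ℂ] Bergman Ω, S.IsTransferOperator L := by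
  set M := eLpNorm (fun z => ∑' i, S.majorant U i z) 2
    ((normVol d).restrict (Ω : Set (Cn d))) with hM
  have hM2 : ∫⁻ z in (Ω : Set (Cn d)), (∑' i, S.majorant U i z) ^ 2 ∂(normVol d) ≠ ∞ := by
    have := ENNReal.pow_lt_top (n := 2) hfin
    rw [eLpNorm_two_sq] at this
    exact this.ne
  have hE : ∀ f : Bergman Ω', eLpNorm f.toFun 2 ((normVol d).restrict (U : Set (Cn d))) ≠ ∞ :=
    fun f => ((Bergman.eLpNorm_le_enorm hUΩ f).trans_lt enorm_lt_top).ne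
  have hterm : ∀ (f : Bergman Ω') (i : I), ∃ G : Bergman Ω,
      EqOn G.toFun (fun z => S.w i z * f (S.φ i z)) Ω := by
    intro f i
    refine Bergman.exists_eqOn ((S.w i).differentiableOn.mul
      (f.differentiableOn.comp (S.holomorphic i) fun z hz => hUΩ (S.mapsTo hU i hz))) ?_
    rw [eLpNorm_two_lt_top_iff]
    calc ∫⁻ z in (Ω : Set (Cn d)), ‖S.w i z * f (S.φ i z)‖ₑ ^ 2 ∂(normVol d)
        ≤ ∫⁻ z in (Ω : Set (Cn d)), (∑' i, S.majorant U i z) ^ 2 *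
            eLpNorm f.toFun 2 ((normVol d).restrict (U : Set (Cn d))) ^ 2 ∂(normVol d) := by
          refine setLIntegral_mono' Ω.isOpen.measurableSet fun z hz => ?_
          rw [← mul_pow]
          gcongr
          refine (S.enorm_term_le hd hU hUΩ hpos f i hz).trans ?_
          gcongr
          exact ENNReal.le_tsum i
      _ < ∞ := by
          rw [lintegral_mul_const' _ _ (ENNReal.pow_ne_top (hE f))]
          exact ENNReal.mul_lt_top hM2.lt_top (ENNReal.pow_lt_top (hE f).lt_top)
  choose G hG using hterm
  have hGle : ∀ (f : Bergman Ω') (i : I), ∀ z ∈ Ω, ‖G f i z‖ₑ ≤ S.majorant U i z *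
      eLpNorm f.toFun 2 ((normVol d).restrict (U : Set (Cn d))) := by
    intro f i z hz
    rw [hG f i hz]
    exact S.enorm_term_le hd hU hUΩ hpos f i hz
  have hsum : ∀ f, Summable (G f) := fun f => Bergman.summable_of_enorm_le (G f) (S.majorant U) _
    (hE f) (hGle f) (S.aemeasurable_majorant U) hM2
  have hadd : ∀ f g, G (f + g) = G f + G g := fun f g => funext fun i => Bergman.ext_on
    fun z hz => by
      rw [hG _ i hz, Pi.add_apply, Bergman.eqOn_add _ _ hz, Pi.add_apply, hG f i hz, hG g i hz]
      beta_reduce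
      rw [Bergman.eqOn_add f g (hUΩ (S.mapsTo hU i hz)), Pi.add_apply, mul_add]
  have hsmul : ∀ (a : ℂ) f, G (a • f) = a • G f := fun a f => funext fun i => Bergman.ext_on
    fun z hz => by
      rw [hG _ i hz, Pi.smul_apply, Bergman.eqOn_smul _ _ hz, Pi.smul_apply, hG f i hz]
      beta_reduce
      rw [Bergman.eqOn_smul a f (hUΩ (S.mapsTo hU i hz)), Pi.smul_apply, smul_eq_mul, smul_eq_mul]
      ring
  let L₀ : Bergman Ω' →ₗ[ℂ] Bergman Ω :=
    { toFun := fun f => ∑' i, G f i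
      map_add' := fun f g => by
        rw [hadd]
        exact (hsum f).tsum_add (hsum g)
      map_smul' := fun a f => by
        rw [hsmul]
        exact (hsum f).tsum_const_smul a }
  refine ⟨L₀.mkContinuous M.toReal fun f => ?_, fun f => ⟨G f, hG f, (hsum f).hasSum⟩⟩
  have h1 := (Bergman.enorm_hasSum_le (G f) (S.majorant U) _ (hE f) (hGle f)
    (hsum f).hasSum).trans (mul_le_mul_right (Bergman.eLpNorm_le_enorm hUΩ f) _)
  have h2 := ENNReal.toReal_mono (ENNReal.mul_ne_top hfin.ne enorm_ne_top) h1
  rw [ENNReal.toReal_mul, toReal_enorm, toReal_enorm] at h2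
  exact h2

end TransferOperator

/-! ### The theorem: the norm bound combined with the contraction on the cover. -/

theorem theorem5p6 {d : ℕ} (hd : 1 ≤ d) {I : Type*} [Countable I]
    (Ω Ω' Ωt : TopologicalSpace.Opens (Cn d))
    (hΩ : (Ω : Set (Cn d)).Nonempty) (hΩt : (Ωt : Set (Cn d)).Nonempty)
    (S : HolomorphicMapWeightSystem Ω Ω' I)
    (h_maps : CompactlyContained (⋃ i, S.φ i '' Ω) (Ωt : Set (Cn d)))
    (h_mid : CompactlyContained (Ωt : Set (Cn d)) (Ω' : Set (Cn d)))
    {N : ℕ} (C : RelativeCover (Ω' : Set (Cn d)) (Ωt : Set (Cn d)) N) :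
    -- the transfer operator of the system exists and is unique
    (∃! L : Bergman Ω' →L[ℂ] Bergman Ω, S.IsTransferOperator L) ∧
    -- the function `∑ |w_i| r_i^{-d}` belongs to `L²(Ω)`
    eLpNorm (fun z => ∑' i, ‖S.w i z‖ₑ *
        ENNReal.ofReal ((setDist (S.φ i '' Ω) (frontier (Ωt : Set (Cn d))))⁻¹ ^ d)) 2
      ((normVol d).restrict (Ω : Set (Cn d))) < ∞ ∧
    ∀ L : Bergman Ω' →L[ℂ] Bergman Ω, S.IsTransferOperator L →
      L ∈ expClass (efficiencyNorm d C.efficiency) (1 / (d : ℝ)) ∧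
      expGauge (efficiencyNorm d C.efficiency) (1 / (d : ℝ)) L ≤
        ENNReal.ofReal (N * Real.exp (-(((d : ℝ) - 1) / 2) * ⨅ n, C.efficiency n)) *
          eLpNorm (fun z => ∑' i, ‖S.w i z‖ₑ *
              ENNReal.ofReal ((setDist (S.φ i '' Ω) (frontier (Ωt : Set (Cn d))))⁻¹ ^ d)) 2
            ((normVol d).restrict (Ω : Set (Cn d))) ∧
      ∀ n : ℕ, 1 ≤ n → singularValue L n ≤
        (expGauge (efficiencyNorm d C.efficiency) (1 / (d : ℝ)) L).toReal *
          Real.exp (-(efficiencyNorm d C.efficiency) * (n : ℝ) ^ (1 / (d : ℝ))) := by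
  have hsub : (Ωt : Set (Cn d)) ⊆ Ω' := subset_closure.trans h_mid.2
  have hNe : Nonempty (Fin N) := by
    obtain ⟨z, hz⟩ := hΩt
    obtain ⟨j, -⟩ := mem_iUnion.1 (C.covers hz)
    exact ⟨j⟩
  obtain ⟨δ, hδ, hδle⟩ := exists_pos_le_setDist (A := fun i => S.φ i '' Ω) Ωt.isOpen h_maps
    (frontier_nonempty_of_compactlyContained hd hΩt h_mid.1)
  have hle : ∀ i, δ ≤ setDist (S.φ i '' Ω) (frontier (Ωt : Set (Cn d))) := fun i =>
    hδle i (hΩ.image _)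
  have hpos := fun i => hδ.trans_le (hle i)
  have hfin := S.eLpNorm_majorant_lt_top hδ hle
  set M := eLpNorm (fun z => ∑' i, S.majorant Ωt i z) 2
    ((normVol d).restrict (Ω : Set (Cn d))) with hM
  set c := efficiencyNorm d C.efficiency with hc
  set P : ℝ := N * Real.exp (-(((d : ℝ) - 1) / 2) * ⨅ n, C.efficiency n) with hP
  have hc0 : 0 < c := efficiencyNorm_pos fun j => Real.log_pos (C.one_lt_scaling j)
  have hP0 : 0 ≤ P := by positivity
  obtain ⟨L₁, hL₁⟩ := S.exists_isTransferOperator hd h_maps hsub hpos hfin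
  refine ⟨⟨L₁, hL₁, fun L hL => hL.unique hL₁⟩, hfin, fun L hL => ?_⟩
  -- One estimate serves twice: for fixed `n` it bounds `s_n`, and as `n → ∞` it gives compactness.
  have hker : ∀ n : ℕ, 1 ≤ n → ∃ K : Fin N → ℕ, ∃ Φ : Bergman Ω' →ₗ[ℂ] (∀ j, boxSpan d (K j)),
      Module.finrank ℂ (∀ j, boxSpan d (K j)) < n ∧ ∀ f : Bergman Ω', Φ f = 0 →
      ‖L f‖ ≤ P * M.toReal * Real.exp (-c * (n : ℝ) ^ (1 / (d : ℝ))) * ‖f‖ := by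
    intro n hn
    obtain ⟨K, Φ, hK, hΦ⟩ := C.exists_linearMap_ker_le_exp hd hn
    refine ⟨K, Φ, hK, fun f hf => ?_⟩
    have h1 := (hL.enorm_le hd h_maps hsub hpos f).trans (mul_le_mul_right (hΦ f hf) _)
    have h2 := ENNReal.toReal_mono (ENNReal.mul_ne_top hfin.ne
      (ENNReal.mul_ne_top ENNReal.ofReal_ne_top enorm_ne_top)) h1
    rw [ENNReal.toReal_mul, ENNReal.toReal_mul, toReal_enorm, toReal_enorm,
      ENNReal.toReal_ofReal (by positivity)] at h2
    refine h2.trans_eq ?_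
    ring
  have hsv : ∀ n : ℕ, 1 ≤ n →
      singularValue L n ≤ P * M.toReal * Real.exp (-c * (n : ℝ) ^ (1 / (d : ℝ))) := by
    intro n hn
    obtain ⟨K, Φ, hK, hΦ⟩ := hker n hn
    exact singularValue_le_of_norm_le_on_ker L Φ hK (by positivity) hΦ
  have hgauge : expGauge c (1 / (d : ℝ)) L ≤ ENNReal.ofReal P * M := by
    refine iSup₂_le fun n hn => ?_
    rw [← ENNReal.ofReal_toReal hfin.ne, ← ENNReal.ofReal_mul hP0]
    refine ENNReal.ofReal_le_ofReal ?_
    calc singularValue L n * Real.exp (c * (n : ℝ) ^ (1 / (d : ℝ)))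
        ≤ P * M.toReal * Real.exp (-c * (n : ℝ) ^ (1 / (d : ℝ))) *
            Real.exp (c * (n : ℝ) ^ (1 / (d : ℝ))) := by
          gcongr
          exact hsv n hn
      _ = P * M.toReal := by rw [mul_assoc, ← Real.exp_add]; simp
  have hgfin : expGauge c (1 / (d : ℝ)) L < ∞ :=
    hgauge.trans_lt (ENNReal.mul_lt_top ENNReal.ofReal_lt_top hfin)
  refine ⟨⟨?_, hgfin⟩, hgauge, fun n hn => ?_⟩
  · refine isCompactOperator_of_forall_exists_norm_le_on_ker L fun ε hε => ?_
    have hlim : Tendsto (fun n : ℕ => P * M.toReal * Real.exp (-c * (n : ℝ) ^ (1 / (d : ℝ))))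
        atTop (𝓝 0) := by
      rw [← mul_zero (P * M.toReal)]
      refine (Real.tendsto_exp_atBot.comp ?_).const_mul _
      refine Tendsto.const_mul_atTop_of_neg (neg_lt_zero.2 hc0) ?_
      exact (tendsto_rpow_atTop (by positivity)).comp tendsto_natCast_atTop_atTop
    obtain ⟨n, hn, hn1⟩ := ((hlim.eventually (gt_mem_nhds hε)).and (eventually_ge_atTop 1)).exists
    obtain ⟨K, Φ, -, hΦ⟩ := hker n hn1
    let e := (Module.finBasis ℂ (∀ j, boxSpan d (K j))).equivFun
    refine ⟨_, e.toLinearMap ∘ₗ Φ, fun f hf => ?_⟩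
    refine (hΦ f (by simpa using hf)).trans ?_
    gcongr
  · have h1 : ENNReal.ofReal (singularValue L n * Real.exp (c * (n : ℝ) ^ (1 / (d : ℝ)))) ≤
        expGauge c (1 / (d : ℝ)) L :=
      le_iSup₂ (f := fun (n : ℕ) (_ : 1 ≤ n) =>
        ENNReal.ofReal (singularValue L n * Real.exp (c * (n : ℝ) ^ (1 / (d : ℝ))))) n hn
    have h2 := (ENNReal.ofReal_le_iff_le_toReal hgfin.ne).1 h1
    rw [neg_mul, Real.exp_neg, ← div_eq_mul_inv, le_div_iff₀ (Real.exp_pos _)]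
    exact h2
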